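/- Let $W(x)=-|x|+\tfrac{|x|^2}{2}$, so that $\partial W(x)=-\operatorname{sgn}(x)+x$, and consider the pressureless damped Euler system $$\rho_t+(\rho u)_x=0,\qquad u_t+uu_x+u=-\partial W\star\rho,\qquad (x,t)\in\mathbb R\times(0,\infty),$$ with initial data $\rho(x,0)=\rho_0(x)>0$, $u(x,0)=u_0(x)$, where $\rho_0,u_0\in C^1(\mathbb R)$ and, for some $\delta>0$, the functions $u_0'$ and $(1+x^2)^{(2+\delta)/2}\rho_0(x)$ are bounded on $\mathbb R$. Put $M_0=\int_{\mathbb R}\rho_0\,dx$. A global solution is a pair $\rho,u\in C^1(\mathbb R\times[0,\infty))$ that satisfies the equations on $\mathbb R\times(0,\infty)$ and the initial conditions, and is such that for every $t\ge 0$ and $i=1,2$ one has $\rho(x,t)|u(x,t)|^i\to0$ as $|x|\to\infty$, and for every $T>0$ there is a constant $C$ with $|x|^{2+\delta}|\rho(x,t)|\le C$ for all $x\in\mathbb R$, $0\le t<T$. Below, the differential equations for $R$ hold in the interior of the interval on which $R$ is defined, where $R\neq0$ is required. 1. (Subcritical mass, $M_0<1/4$.) There is a unique continuous $R_a:[0,\infty)\to[0,\infty)$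 satisfying $$\frac{dR_a}{ds}=1+\frac{1}{R_a}(2-M_0s),\qquad R_a(0)=0,$$ and there exists a unique global solution if and only if $u_0\in C^2(\mathbb R)$ and, for all $x\in\mathbb R$, $$(\rho_0(x),u_0'(x))\in\{(\rho,d): d>-\rho R_a(1/\rho),\ \rho>0\}.$$ 2. (Critical mass, $M_0=1/4$.) There is a unique continuous $R_b:[0,\infty)\to[0,\infty)$ satisfying $$\frac{dR_b}{ds}=1+\frac{1}{R_b}\Bigl(2-\frac s4\Bigr),\qquad R_b(0)=0,$$ and there exists a unique global solution if and only if $u_0\in C^2(\mathbb R)$ and, for all $x\in\mathbb R$, $$(\rho_0(x),u_0'(x))\in\{(\rho,d): d>-\rho R_b(1/\rho),\ \rho>0\}.$$ 3. (Supercritical mass, $M_0>1/4$.) Let $$\gamma=\frac{2}{M_0}\left(1+e^{\frac{\pi}{\sqrt{4M_0-1}}}\right).$$ There are a unique continuous $R_1:[0,\gamma]\to[0,\infty)$ satisfying $$\frac{dR_1}{ds}=1+\frac{1}{R_1}(2-M_0s),\qquad R_1(0)=0,$$ and a unique continuous $R_2:[0,\gamma]\to(-\infty,0]$ satisfying $$\frac{dR_2}{ds}=-1+\frac{1}{R_2}\bigl(M_0(\gamma-s)-2\bigr),\qquad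 R_2(0)=0,$$ and there exists a unique global solution if and only if $u_0\in C^2(\mathbb R)$ and, for all $x\in\mathbb R$, $$(\rho_0(x),u_0'(x))\in\{(\rho,d): -\rho R_1(1/\rho)<d<-\rho R_2(\gamma-1/\rho),\ \rho\in(1/\gamma,\infty)\}.$$ -/

import Mathlib

open Set Filter Topology MeasureTheory

namespace Aggregation

/-- The interaction potential `W(x) = -|x| + |x|²/2`. -/
noncomputable def W (x : ℝ) : ℝ := -|x| + |x| ^ 2 / 2

/-- The derivative `∂W(x) = -sgn(x) + x` of the interaction potential. -/
noncomputable def dW (x : ℝ) : ℝ := -Real.sign x + x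

/-- `dW` is the derivative of `W` away from the kink at the origin. -/
theorem hasDerivAt_W {x : ℝ} (hx : x ≠ 0) : HasDerivAt W (dW x) x := by
  have h2 : HasDerivAt (fun y : ℝ => y ^ 2 / 2) x x := by
    have h := (hasDerivAt_pow 2 x).div_const 2
    refine h.congr_deriv ?_
    norm_num
  have hW : W = fun y : ℝ => -|y| + y ^ 2 / 2 := by
    funext y
    simp [W, sq_abs]
  rw [hW]
  have h1 : HasDerivAt (fun y : ℝ => -|y|) (-Real.sign x) x := by
    rcases lt_or_gt_of_ne hx with h | h
    · rw [Real.sign_of_neg h]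
      exact (hasDerivAt_abs_neg h).fun_neg
    · rw [Real.sign_of_pos h]
      exact (hasDerivAt_abs_pos h).fun_neg
  exact h1.add h2

/-- The nonlocal term `(∂W ⋆ σ)(x) = ∫ ∂W(x - y) σ(y) dy`. -/
noncomputable def dWConv (σ : ℝ → ℝ) (x : ℝ) : ℝ := ∫ y, dW (x - y) * σ y

/-- The total mass `M₀ = ∫ ρ₀`. -/
noncomputable def mass (ρ₀ : ℝ → ℝ) : ℝ := ∫ x, ρ₀ x

/-- Global classical solutions of
`ρ_t + (ρ u)_x = 0`, `u_t + u u_x + u = -∂W ⋆ ρ` on `ℝ × (0, ∞)`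
with initial data `(ρ₀, u₀)`, of class `C¹` up to the initial time and with the far-field behaviour
`ρ |u|^i → 0` (`i = 1, 2`) and `|x|^{2+δ} ρ = O(1)`, the latter uniformly on bounded time
intervals. A pair is written as `ρ x t`, `u x t`; only the values for `t ≥ 0` are relevant. -/
structure IsGlobalSolution (δ : ℝ) (ρ₀ u₀ : ℝ → ℝ) (ρ u : ℝ → ℝ → ℝ) : Prop where
  contDiff_density : ContDiffOn ℝ 1 (fun p : ℝ × ℝ => ρ p.1 p.2) (univ ×ˢ Ici 0)
  contDiff_velocity : ContDiffOn ℝ 1 (fun p : ℝ × ℝ => u p.1 p.2) (univ ×ˢ Ici 0)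
  continuity_eq : ∀ x t : ℝ, 0 < t →
    deriv (fun τ => ρ x τ) t + deriv (fun y => ρ y t * u y t) x = 0
  momentum_eq : ∀ x t : ℝ, 0 < t →
    deriv (fun τ => u x τ) t + u x t * deriv (fun y => u y t) x + u x t
      = -dWConv (fun y => ρ y t) x
  initial_density : ∀ x : ℝ, ρ x 0 = ρ₀ x
  initial_velocity : ∀ x : ℝ, u x 0 = u₀ x
  flux_vanishes : ∀ t : ℝ, 0 ≤ t → ∀ i : ℕ, i = 1 ∨ i = 2 →
    Tendsto (fun x => ρ x t * |u x t| ^ i) (cocompact ℝ) (𝓝 0)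
  density_decay : ∀ T : ℝ, 0 < T → ∃ C : ℝ, ∀ x t : ℝ, 0 ≤ t → t < T →
    |x| ^ (2 + δ) * |ρ x t| ≤ C

/-- There is exactly one global solution (as a pair of functions on `ℝ × [0, ∞)`). -/
def HasUniqueGlobalSolution (δ : ℝ) (ρ₀ u₀ : ℝ → ℝ) : Prop :=
  ∃ ρ u : ℝ → ℝ → ℝ, IsGlobalSolution δ ρ₀ u₀ ρ u ∧
    ∀ ρ' u' : ℝ → ℝ → ℝ, IsGlobalSolution δ ρ₀ u₀ ρ' u' →
      ∀ x t : ℝ, 0 ≤ t → ρ' x t = ρ x t ∧ u' x t = u x t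

/-- `R` is continuous on the interval `J`, starts from `R(0) = 0`, and solves
`dR/ds = a + g(s)/R` in the interior of `J`, where the equation requires `R ≠ 0`. -/
structure IsBranch (a : ℝ) (g : ℝ → ℝ) (J : Set ℝ) (R : ℝ → ℝ) : Prop where
  continuousOn : ContinuousOn R J
  zero : R 0 = 0
  ne_zero : ∀ s ∈ interior J, R s ≠ 0
  ode : ∀ s ∈ interior J, HasDerivAt R (a + 1 / R s * g s) s

/-- The nonnegative branch on `J`: `dR/ds = 1 + (2 - M s)/R`, `R(0) = 0`, `R ≥ 0`. -/
def IsUpperBranch (M : ℝ) (J : Set ℝ) (R : ℝ → ℝ) : Prop :=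
  IsBranch 1 (fun s => 2 - M * s) J R ∧ ∀ s ∈ J, 0 ≤ R s

/-- The nonpositive branch on `[0, γ]`:
`dR/ds = -1 + (M (γ - s) - 2)/R`, `R(0) = 0`, `R ≤ 0`. -/
def IsLowerBranch (M γ : ℝ) (R : ℝ → ℝ) : Prop :=
  IsBranch (-1) (fun s => M * (γ - s) - 2) (Icc 0 γ) R ∧ ∀ s ∈ Icc 0 γ, R s ≤ 0

/-- The set `{(ρ, d) : d > -ρ R(1/ρ), ρ > 0}`. -/
def regionAbove (R : ℝ → ℝ) : Set (ℝ × ℝ) :=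
  {p | -p.1 * R (1 / p.1) < p.2 ∧ 0 < p.1}

/-- The set `{(ρ, d) : -ρ R₁(1/ρ) < d < -ρ R₂(γ - 1/ρ), ρ > 1/γ}`. -/
def regionBetween (γ : ℝ) (R₁ R₂ : ℝ → ℝ) : Set (ℝ × ℝ) :=
  {p | -p.1 * R₁ (1 / p.1) < p.2 ∧ p.2 < -p.1 * R₂ (γ - 1 / p.1) ∧ 1 / γ < p.1}

/-- `γ = (2/M) (1 + exp(π / √(4M - 1)))`. -/
noncomputable def gammaStar (M : ℝ) : ℝ :=
  2 / M * (1 + Real.exp (Real.pi / Real.sqrt (4 * M - 1)))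

end Aggregation

/-!
In Lagrangian coordinates the system is linear. Along a characteristic `X(α, t)` the nonlocal force is
`(mass to the left of α) - (mass to the right) - M X + ∫ X ρ₀`, with `M` the conserved mass, so the
Jacobian `J = ∂X/∂α` solves `J'' + J' + M J = 2 ρ₀(α)`, `J(0) = 1`, `J'(0) = u₀'(α)`; this is the
explicit function `jac`. A classical solution exists for all time exactly when `J` stays positive and
the density `ρ₀ / J` is `C¹`, that is, when `u₀` is `C²`.

Positivity is read off from the quotient `s = J / ρ₀`, which solves `s'' + s' + M s = 2` with initial
values `1 / ρ₀` and `u₀' / ρ₀`. Let `η'' = η' - M η`, `η(0) = 0`, `η'(0) = 1`. The trajectory reaching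
`s = 0` at rest is, backwards in time, `τ ↦ (curve τ, -2 η(τ))`, so it is the graph of `-R` with
`R (curve τ) = 2 η τ`. For `M ≤ 1/4` the function `curve` increases from `0` to `∞` on `[0, ∞)`, and
starting from `s(0) = curve τ` one has the decomposition `IsFundamental.jac_eq` of `s(t)` into
`curve (τ - t) ≥ 0` and a positive multiple of `u₀' / ρ₀ + R(1 / ρ₀)`. At `t = τ` the first term
vanishes, which gives the criterion `IsFundamental.jac_pos_iff`. For `M > 1/4` the trajectory spirals:
its first two half-turns are the graphs of `R₁` and `R₂`. The density tends to `0` at infinity, where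
`J` becomes negative after half a period, so there is never a global solution; nor can `ρ₀ > 1 / γ`
hold everywhere.

That every global solution has this form (`IsGlobalSolution.exists_flow`) needs no assumption on the
growth of `u`: the force field is Lipschitz in space by the decay of the density, so Newton's law has
solutions on all of `[0, T]` through every point of space-time, and they are characteristics of `u` by
a Grönwall argument. The mass between two characteristics is constant, which determines their
separation explicitly, and hence the flow, its Jacobian and the solution
(`IsGlobalSolution.unique`). Conversely, `exists_isGlobalSolution` inverts the explicit flow, using a
lower bound for `J` that comes from `IsFundamental.exp_le_jac` far away and from compactness elsewhere.
-/

namespace Aggregation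

/-! ### Grönwall estimates and second-order equations -/

/-- Grönwall's inequality for a differential inequality `|E'| ≤ K E`, forwards and backwards in
time. Only the interior derivative is used, so it applies to classical solutions up to the initial time. -/
theorem le_mul_exp_of_abs_deriv_le {E E' : ℝ → ℝ} {a b K : ℝ}
    (hc : ContinuousOn E (Icc a b)) (hd : ∀ t ∈ Ioo a b, HasDerivAt E (E' t) t)
    (hb : ∀ t ∈ Ioo a b, |E' t| ≤ K * E t) {s t : ℝ} (hs : s ∈ Icc a b) (ht : t ∈ Icc a b) :
    E t ≤ E s * Real.exp (K * |t - s|) := by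
  have hexp : ∀ c : ℝ, ∀ t : ℝ,
      HasDerivAt (fun t => Real.exp (c * t)) (Real.exp (c * t) * (c * 1)) t := fun c t =>
    ((hasDerivAt_id t).const_mul c).exp
  have hce : ∀ c : ℝ, ContinuousOn (fun t => E t * Real.exp (c * t)) (Icc a b) := fun c =>
    hc.mul (by fun_prop)
  have hde : ∀ c : ℝ, ∀ t ∈ Ioo a b, HasDerivAt (fun t => E t * Real.exp (c * t))
      ((E' t + c * E t) * Real.exp (c * t)) t := fun c t ht => by
    refine ((hd t ht).mul (hexp c t)).congr_deriv ?_
    ring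
  have hanti : AntitoneOn (fun t => E t * Real.exp (-K * t)) (Icc a b) := by
    refine antitoneOn_of_deriv_nonpos (convex_Icc a b) (hce _) ?_ ?_
    · rw [interior_Icc]
      exact fun t ht => (hde _ t ht).differentiableAt.differentiableWithinAt
    · rw [interior_Icc]
      intro t ht
      rw [(hde _ t ht).deriv]
      have := (abs_le.1 (hb t ht)).2
      exact mul_nonpos_of_nonpos_of_nonneg (by linarith) (Real.exp_pos _).le
  have hmono : MonotoneOn (fun t => E t * Real.exp (K * t)) (Icc a b) := by
    refine monotoneOn_of_deriv_nonneg (convex_Icc a b) (hce _) ?_ ?_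
    · rw [interior_Icc]
      exact fun t ht => (hde _ t ht).differentiableAt.differentiableWithinAt
    · rw [interior_Icc]
      intro t ht
      rw [(hde _ t ht).deriv]
      have := (abs_le.1 (hb t ht)).1
      exact mul_nonneg (by linarith) (Real.exp_pos _).le
  rcases le_total s t with h | h
  · have h1 := hanti hs ht h
    simp only at h1
    rw [abs_of_nonneg (sub_nonneg.2 h)]
    calc E t = E t * Real.exp (-K * t) * Real.exp (K * t) := by
          rw [mul_assoc, ← Real.exp_add]; simp
      _ ≤ E s * Real.exp (-K * s) * Real.exp (K * t) := by gcongr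
      _ = _ := by rw [mul_assoc, ← Real.exp_add]; ring_nf
  · have h1 := hmono ht hs h
    simp only at h1
    rw [abs_of_nonpos (sub_nonpos.2 h)]
    calc E t = E t * Real.exp (K * t) * Real.exp (-K * t) := by
          rw [mul_assoc, ← Real.exp_add]; simp
      _ ≤ E s * Real.exp (K * s) * Real.exp (-K * t) := by gcongr
      _ = _ := by rw [mul_assoc, ← Real.exp_add]; ring_nf

theorem eq_zero_of_abs_deriv_le {E E' : ℝ → ℝ} {a b K : ℝ}
    (hc : ContinuousOn E (Icc a b)) (hd : ∀ t ∈ Ioo a b, HasDerivAt E (E' t) t)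
    (hb : ∀ t ∈ Ioo a b, |E' t| ≤ K * E t) (h0 : ∀ t ∈ Icc a b, 0 ≤ E t)
    {s : ℝ} (hs : s ∈ Icc a b) (hEs : E s = 0) : ∀ t ∈ Icc a b, E t = 0 := fun t ht =>
  le_antisymm (by simpa [hEs] using le_mul_exp_of_abs_deriv_le hc hd hb hs ht) (h0 t ht)

/-- Uniqueness for the second-order inequality `|y''| ≤ K (|y| + |y'|)`, with data prescribed at any
time of the interval. -/
theorem eq_zero_of_second_order {y v a : ℝ → ℝ} {c d K : ℝ} (hK : 0 ≤ K)
    (hyc : ContinuousOn y (Icc c d)) (hvc : ContinuousOn v (Icc c d))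
    (hy : ∀ t ∈ Ioo c d, HasDerivAt y (v t) t) (hv : ∀ t ∈ Ioo c d, HasDerivAt v (a t) t)
    (ha : ∀ t ∈ Ioo c d, |a t| ≤ K * (|y t| + |v t|))
    {s : ℝ} (hs : s ∈ Icc c d) (hys : y s = 0) (hvs : v s = 0) :
    ∀ t ∈ Icc c d, y t = 0 ∧ v t = 0 := by
  have key : ∀ t ∈ Icc c d, y t ^ 2 + v t ^ 2 = 0 := by
    refine eq_zero_of_abs_deriv_le (E' := fun t => 2 * y t * v t + 2 * v t * a t) (K := 1 + 3 * K)
      ((hyc.pow 2).add (hvc.pow 2)) ?_ ?_ (fun t _ => by positivity) hs (by simp [hys, hvs])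
    · intro t ht
      refine (((hy t ht).pow 2).add ((hv t ht).pow 2)).congr_deriv ?_
      norm_num
    · intro t ht
      have h := ha t ht
      have h1 : |2 * y t * v t| ≤ y t ^ 2 + v t ^ 2 := by
        rw [abs_le]; constructor <;> nlinarith [sq_nonneg (y t + v t), sq_nonneg (y t - v t)]
      have h2 : |2 * v t * a t| ≤ 3 * K * (y t ^ 2 + v t ^ 2) := by
        rw [abs_mul, abs_mul, abs_two]
        calc 2 * |v t| * |a t| ≤ 2 * |v t| * (K * (|y t| + |v t|)) := by gcongr
          _ = K * (2 * |v t| * |y t| + 2 * |v t| ^ 2) := by ring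
          _ ≤ K * (3 * (|y t| ^ 2 + |v t| ^ 2)) := by
              gcongr
              nlinarith [sq_nonneg (|v t| - |y t|), sq_nonneg (|y t|)]
          _ = _ := by rw [sq_abs, sq_abs]; ring
      refine (abs_add_le _ _).trans ?_
      linarith
  intro t ht
  have := key t ht
  constructor <;> nlinarith [sq_nonneg (y t), sq_nonneg (v t)]

theorem abs_le_of_eq_damped {M y v a : ℝ} (h : a = -v - M * y) :
    |a| ≤ (1 + |M|) * (|y| + |v|) := by
  rw [h]
  calc |-v - M * y| ≤ |-v| + |M * y| := abs_sub _ _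
    _ = |v| + |M| * |y| := by rw [abs_neg, abs_mul]
    _ ≤ _ := by nlinarith [abs_nonneg y, abs_nonneg v, abs_nonneg M,
        mul_nonneg (abs_nonneg M) (abs_nonneg v)]

/-- The truncation of a real number to `[-R, R]`. -/
noncomputable def clamp (R x : ℝ) : ℝ := max (-R) (min R x)

theorem abs_clamp_sub_clamp_le (R x y : ℝ) : |clamp R x - clamp R y| ≤ |x - y| := by
  unfold clamp
  calc _ ≤ _ := abs_max_sub_max_le_max _ _ _ _
    _ ≤ |x - y| := by
      simp only [sub_self, abs_zero]
      refine max_le (abs_nonneg _) ?_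
      refine (abs_min_sub_min_le_max _ _ _ _).trans ?_
      simp

theorem abs_clamp_le {R : ℝ} (hR : 0 ≤ R) (x : ℝ) : |clamp R x| ≤ R := by
  unfold clamp
  rw [abs_le]
  exact ⟨le_max_left _ _, max_le (by linarith) (min_le_left _ _)⟩

theorem clamp_of_abs_le {R x : ℝ} (h : |x| ≤ R) : clamp R x = x := by
  unfold clamp
  rw [min_eq_right (abs_le.1 h).2, max_eq_right (abs_le.1 h).1]

theorem abs_clamp_le_abs {R : ℝ} (hR : 0 ≤ R) (x : ℝ) : |clamp R x| ≤ |x| := by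
  have h := abs_clamp_sub_clamp_le R x 0
  rwa [clamp_of_abs_le (R := R) (x := 0) (by simpa using hR), sub_zero, sub_zero] at h

/-- Global solvability on `[0, T]`, forwards and backwards from any time, of a second-order equation
whose force is globally Lipschitz in space. The velocity and position entering the right-hand side
are truncated, which makes Picard-Lindelöf applicable on the whole interval, and the a priori bound
shows that the truncation is inactive. -/
theorem exists_second_order_solution {T K : ℝ} (hT : 0 ≤ T) (hK : 0 ≤ K) {H : ℝ → ℝ → ℝ}
    (hLip : ∀ t ∈ Icc 0 T, ∀ x y, |H x t - H y t| ≤ K * |x - y|)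
    (hc : ∀ x, ContinuousOn (H x) (Icc 0 T)) {t₀ : ℝ} (ht₀ : t₀ ∈ Icc 0 T) (x₀ v₀ : ℝ) :
    ∃ Y V : ℝ → ℝ, Y t₀ = x₀ ∧ V t₀ = v₀ ∧ ContinuousOn Y (Icc 0 T) ∧ ContinuousOn V (Icc 0 T) ∧
      (∀ t ∈ Ioo 0 T, HasDerivAt Y (V t) t) ∧
      ∀ t ∈ Ioo 0 T, HasDerivAt V (-V t + H (Y t) t) t := by
  obtain ⟨B, hB⟩ := isCompact_Icc.exists_bound_of_continuousOn (hc 0)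
  have hB0 : 0 ≤ B := (norm_nonneg _).trans (hB 0 ⟨le_rfl, hT⟩)
  have hH : ∀ t ∈ Icc 0 T, ∀ x, |H x t| ≤ B + K * |x| := fun t ht x => by
    have h1 := hLip t ht x 0
    have h2 := hB t ht
    rw [Real.norm_eq_abs] at h2
    rw [sub_zero] at h1
    calc |H x t| = |(H x t - H 0 t) + H 0 t| := by ring_nf
      _ ≤ _ := abs_add_le _ _
      _ ≤ _ := by linarith
  -- the a priori bound for `1 + Y² + V²`
  set K' : ℝ := 3 + 2 * B + 2 * K with hK'
  have hK'0 : 0 ≤ K' := by positivity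
  set R : ℝ := (1 + x₀ ^ 2 + v₀ ^ 2) * Real.exp (K' * T) with hR
  have hR0 : 0 ≤ R := by positivity
  let f : ℝ → ℝ × ℝ → ℝ × ℝ := fun t p =>
    (clamp R p.2, -clamp R p.2 + H (clamp R p.1) t)
  have hfl : ∀ t ∈ Icc 0 T, LipschitzWith (Real.toNNReal (1 + K)) (f t) := fun t ht => by
    refine LipschitzWith.of_dist_le_mul fun p q => ?_
    rw [Real.coe_toNNReal _ (by positivity)]
    have e1 : |p.1 - q.1| ≤ dist p q := by rw [← Real.dist_eq]; exact le_max_left _ _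
    have e2 : |p.2 - q.2| ≤ dist p q := by rw [← Real.dist_eq]; exact le_max_right _ _
    have e3 := abs_clamp_sub_clamp_le R p.2 q.2
    have e4 := abs_clamp_sub_clamp_le R p.1 q.1
    have e5 := hLip t ht (clamp R p.1) (clamp R q.1)
    have e6 : K * |clamp R p.1 - clamp R q.1| ≤ K * dist p q := by gcongr; linarith
    have hd := dist_nonneg (x := p) (y := q)
    rw [Prod.dist_eq]
    refine max_le ?_ ?_
    · change dist (clamp R p.2) (clamp R q.2) ≤ _
      rw [Real.dist_eq]
      nlinarith
    · change dist (-clamp R p.2 + H (clamp R p.1) t) (-clamp R q.2 + H (clamp R q.1) t) ≤ _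
      rw [Real.dist_eq]
      calc _ = |-(clamp R p.2 - clamp R q.2) + (H (clamp R p.1) t - H (clamp R q.1) t)| := by
            ring_nf
        _ ≤ _ := abs_add_le _ _
        _ ≤ _ := by rw [abs_neg]; linarith
  set L : ℝ := R + (B + K * R) with hL
  have hL0 : 0 ≤ L := by positivity
  have hPL : IsPicardLindelof f (⟨t₀, ht₀⟩ : Icc 0 T) (x₀, v₀) (Real.toNNReal (L * T)) 0
      (Real.toNNReal L) (Real.toNNReal (1 + K)) := by
    refine ⟨fun t ht => (hfl t ht).lipschitzOnWith, ?_, ?_, ?_⟩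
    · intro p _
      exact continuousOn_const.prodMk (continuousOn_const.add (hc _))
    · intro t ht p _
      rw [Real.coe_toNNReal _ hL0, Prod.norm_def]
      have e1 := abs_clamp_le hR0 p.2
      have e2 := hH t ht (clamp R p.1)
      have e3 : K * |clamp R p.1| ≤ K * R := by gcongr; exact abs_clamp_le hR0 p.1
      refine max_le ?_ ?_
      · change |clamp R p.2| ≤ L
        have : 0 ≤ K * R := by positivity
        linarith
      · change |-clamp R p.2 + H (clamp R p.1) t| ≤ L
        refine (abs_add_le _ _).trans ?_
        rw [abs_neg]
        linarith
    · rw [Real.coe_toNNReal _ hL0, Real.coe_toNNReal _ (by positivity)]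
      simp only [NNReal.coe_zero, sub_zero]
      gcongr
      exact max_le (by linarith [ht₀.1]) ht₀.2
  obtain ⟨α, hα0, hα⟩ := hPL.exists_eq_forall_mem_Icc_hasDerivWithinAt₀
  have hαc : ContinuousOn α (Icc 0 T) := fun t ht => (hα t ht).continuousWithinAt
  have hd : ∀ t ∈ Ioo 0 T, HasDerivAt α (f t (α t)) t := fun t ht =>
    (hα t (Ioo_subset_Icc_self ht)).hasDerivAt (Icc_mem_nhds ht.1 ht.2)
  have hd1 : ∀ t ∈ Ioo 0 T, HasDerivAt (fun t => (α t).1) (clamp R (α t).2) t := fun t ht =>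
    (hd t ht).fst
  have hd2 : ∀ t ∈ Ioo 0 T, HasDerivAt (fun t => (α t).2)
      (-clamp R (α t).2 + H (clamp R (α t).1) t) t := fun t ht =>
    (hd t ht).snd
  have hbound : ∀ t ∈ Icc 0 T, 1 + (α t).1 ^ 2 + (α t).2 ^ 2 ≤ R := by
    intro t ht
    have := le_mul_exp_of_abs_deriv_le (a := 0) (b := T) (K := K')
      (E := fun t => 1 + (α t).1 ^ 2 + (α t).2 ^ 2)
      (E' := fun t => 2 * (α t).1 * clamp R (α t).2 +
        2 * (α t).2 * (-clamp R (α t).2 + H (clamp R (α t).1) t))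
      ((continuousOn_const.add (hαc.fst.pow 2)).add (hαc.snd.pow 2)) ?_ ?_ ht₀ ht
    · refine this.trans ?_
      rw [hα0, hR]
      gcongr
      rw [abs_le]
      constructor <;> linarith [ht.1, ht.2, ht₀.1, ht₀.2]
    · intro t ht
      refine ((((hd1 t ht).pow 2).const_add 1).add ((hd2 t ht).pow 2)).congr_deriv ?_
      norm_num
    · intro t ht
      have e1 := abs_clamp_le_abs hR0 (α t).2
      have e2 := hH t (Ioo_subset_Icc_self ht) (clamp R (α t).1)
      have e3 : K * |clamp R (α t).1| ≤ K * |(α t).1| := 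
        mul_le_mul_of_nonneg_left (abs_clamp_le_abs hR0 _) hK
      generalize (α t).1 = y at *
      generalize (α t).2 = v at *
      have f1 : |2 * y * clamp R v| ≤ 2 * |y| * |v| := by
        rw [abs_mul, abs_mul, abs_two]; gcongr
      have f2 : |2 * v * (-clamp R v + H (clamp R y) t)| ≤ 2 * |v| * (|v| + (B + K * |y|)) := by
        rw [abs_mul, abs_mul, abs_two]
        gcongr
        refine (abs_add_le _ _).trans ?_
        rw [abs_neg]
        linarith
      have f3 : 2 * |y| * |v| ≤ y ^ 2 + v ^ 2 := by
        rw [← sq_abs y, ← sq_abs v]; nlinarith [sq_nonneg (|y| - |v|)]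
      have f4 : 2 * |v| ≤ 1 + v ^ 2 := by
        rw [← sq_abs v]; nlinarith [sq_nonneg (|v| - 1)]
      calc |2 * y * clamp R v + 2 * v * (-clamp R v + H (clamp R y) t)|
          ≤ |2 * y * clamp R v| + |2 * v * (-clamp R v + H (clamp R y) t)| := abs_add_le _ _
        _ ≤ 2 * |y| * |v| + 2 * |v| * (|v| + (B + K * |y|)) := by linarith
        _ = 2 * |y| * |v| + 2 * |v| ^ 2 + B * (2 * |v|) + K * (2 * |y| * |v|) := by ring
        _ ≤ (y ^ 2 + v ^ 2) + 2 * v ^ 2 + B * (1 + v ^ 2) + K * (y ^ 2 + v ^ 2) := by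
            rw [sq_abs]; gcongr
        _ ≤ K' * (1 + y ^ 2 + v ^ 2) := by
            rw [hK']
            nlinarith [sq_nonneg y, sq_nonneg v, mul_nonneg hB0 (sq_nonneg y),
              mul_nonneg hB0 (sq_nonneg v), mul_nonneg hK (sq_nonneg y),
              mul_nonneg hK (sq_nonneg v)]
  have habs : ∀ x y : ℝ, 1 + x ^ 2 + y ^ 2 ≤ R → |x| ≤ R ∧ |y| ≤ R := fun x y h => by
    constructor
    · nlinarith [sq_nonneg (|x| - 1), sq_abs x, sq_nonneg y]
    · nlinarith [sq_nonneg (|y| - 1), sq_abs y, sq_nonneg x]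
  refine ⟨fun t => (α t).1, fun t => (α t).2, congrArg Prod.fst hα0,
    congrArg Prod.snd hα0, hαc.fst, hαc.snd, fun t ht => ?_, fun t ht => ?_⟩
  · have := habs _ _ (hbound t (Ioo_subset_Icc_self ht))
    simpa only [clamp_of_abs_le this.2] using hd1 t ht
  · have := habs _ _ (hbound t (Ioo_subset_Icc_self ht))
    simpa only [clamp_of_abs_le this.2, clamp_of_abs_le this.1] using hd2 t ht

/-! ### The fundamental solution, the backward trajectory and the Jacobian -/

/-- `η` is the solution of `η'' = η' - M η`, `η(0) = 0`, `η'(0) = 1`, and `η'` is its derivative. This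
is the time reversal of the homogeneous equation `y'' + y' + M y = 0` of the Lagrangian flow. -/
structure IsFundamental (M : ℝ) (η η' : ℝ → ℝ) : Prop where
  zero : η 0 = 0
  one : η' 0 = 1
  hasDerivAt : ∀ t, HasDerivAt η (η' t) t
  hasDerivAt' : ∀ t, HasDerivAt η' (η' t - M * η t) t

/-- The factor `e^{t/2}` removes the first-order term: `S'' = (1/4 - M) S` turns into
`η'' = η' - M η` for `η = e^{t/2} S`. -/
theorem isFundamental_of_oscillator {M : ℝ} {S S' : ℝ → ℝ} (h0 : S 0 = 0) (h1 : S' 0 = 1)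
    (hS : ∀ t, HasDerivAt S (S' t) t) (hS' : ∀ t, HasDerivAt S' ((1 / 4 - M) * S t) t) :
    IsFundamental M (fun t => Real.exp (t / 2) * S t)
      (fun t => Real.exp (t / 2) * (S t / 2 + S' t)) := by
  have he : ∀ t : ℝ, HasDerivAt (fun t => Real.exp (t / 2)) (Real.exp (t / 2) * (1 / 2)) t :=
    fun t => ((hasDerivAt_id t).div_const 2).exp
  refine ⟨by simp [h0], by simp [h0, h1], fun t => ?_, fun t => ?_⟩
  · refine ((he t).mul (hS t)).congr_deriv ?_
    ring
  · refine ((he t).mul (((hS t).div_const 2).add (hS' t))).congr_deriv ?_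
    simp only [Pi.add_apply]
    ring

/-- Up to the critical mass nothing oscillates: `η` has the sign of its argument. -/
theorem exists_isFundamental_of_le {M : ℝ} (hM : M ≤ 1 / 4) :
    ∃ η η' : ℝ → ℝ, IsFundamental M η η' ∧ (∀ t, 0 ≤ t → t ≤ η t) ∧ ∀ t < 0, η t < 0 := by
  suffices h : ∃ S S' : ℝ → ℝ, S 0 = 0 ∧ S' 0 = 1 ∧ (∀ t, HasDerivAt S (S' t) t) ∧
      (∀ t, HasDerivAt S' ((1 / 4 - M) * S t) t) ∧ (∀ t, 0 ≤ t → t ≤ S t) ∧ ∀ t < 0, S t < 0 by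
    obtain ⟨S, S', h0, h1, hS, hS', hpos, hneg⟩ := h
    refine ⟨_, _, isFundamental_of_oscillator h0 h1 hS hS', fun t ht => ?_, fun t ht => ?_⟩
    · have h1 : 1 ≤ Real.exp (t / 2) := Real.one_le_exp (by linarith)
      have h2 := hpos t ht
      nlinarith
    · exact mul_neg_of_pos_of_neg (Real.exp_pos _) (hneg t ht)
  rcases hM.eq_or_lt with rfl | hlt
  · refine ⟨fun t => t, fun _ => 1, rfl, rfl, fun t => hasDerivAt_id t, fun t => ?_,
      fun t _ => le_rfl, fun t ht => ht⟩
    simpa using hasDerivAt_const t (1 : ℝ)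
  · set κ := Real.sqrt (1 / 4 - M) with hκ
    have hκ0 : 0 < κ := Real.sqrt_pos.2 (by linarith)
    have hκ2 : κ ^ 2 = 1 / 4 - M := Real.sq_sqrt (by linarith)
    have hl : ∀ t : ℝ, HasDerivAt (fun t => κ * t) κ t := fun t => by
      simpa using (hasDerivAt_id t).const_mul κ
    refine ⟨fun t => Real.sinh (κ * t) / κ, fun t => Real.cosh (κ * t), by simp, by simp,
      fun t => ?_, fun t => ?_, fun t ht => ?_, fun t ht => ?_⟩
    · refine ((hl t).sinh.div_const κ).congr_deriv ?_
      field_simp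
    · refine (hl t).cosh.congr_deriv ?_
      rw [← hκ2]
      field_simp
    · rw [le_div_iff₀ hκ0, mul_comm]
      exact Real.self_le_sinh_iff.2 (by positivity)
    · exact div_neg_of_neg_of_pos (Real.sinh_neg_iff.2 (mul_neg_of_pos_of_neg hκ0 ht)) hκ0

theorem isFundamental_of_gt {M : ℝ} (hM : 1 / 4 < M) :
    IsFundamental M
      (fun t => Real.exp (t / 2) * (Real.sin (Real.sqrt (M - 1 / 4) * t) / Real.sqrt (M - 1 / 4)))
      (fun t => Real.exp (t / 2) *
        (Real.sin (Real.sqrt (M - 1 / 4) * t) / Real.sqrt (M - 1 / 4) / 2 +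
          Real.cos (Real.sqrt (M - 1 / 4) * t))) := by
  set ω := Real.sqrt (M - 1 / 4) with hω
  have hω0 : 0 < ω := Real.sqrt_pos.2 (by linarith)
  have hω2 : ω ^ 2 = M - 1 / 4 := Real.sq_sqrt (by linarith)
  have hl : ∀ t : ℝ, HasDerivAt (fun t => ω * t) ω t := fun t => by
    simpa using (hasDerivAt_id t).const_mul ω
  refine isFundamental_of_oscillator (S := fun t => Real.sin (ω * t) / ω)
    (S' := fun t => Real.cos (ω * t)) (by simp) (by simp) (fun t => ?_) fun t => ?_
  · refine ((hl t).sin.div_const ω).congr_deriv ?_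
    field_simp
  · refine (hl t).cos.congr_deriv ?_
    rw [show 1 / 4 - M = -ω ^ 2 by rw [hω2]; ring]
    field_simp

/-- The backward trajectory `s'' = s' - M s + 2` of the reciprocal density that starts at rest from
`s = 0`; its velocity is `2 η`. -/
noncomputable def curve (M : ℝ) (η η' : ℝ → ℝ) (t : ℝ) : ℝ := 2 / M * (1 + η t - η' t)

/-- The Jacobian of the Lagrangian flow at time `t`, where `r` is the initial density and `d` the
initial velocity gradient: the solution of `J'' + J' + M J = 2 r`, `J(0) = 1`, `J'(0) = d`. -/
noncomputable def jac (M : ℝ) (η η' : ℝ → ℝ) (r d t : ℝ) : ℝ :=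
  Real.exp (-t) * η' t + d * (Real.exp (-t) * η t) + 2 / M * (1 - Real.exp (-t) * η' t) * r

namespace IsFundamental

variable {M : ℝ} {η η' : ℝ → ℝ}

theorem continuous (h : IsFundamental M η η') : Continuous η :=
  continuous_iff_continuousAt.2 fun t => (h.hasDerivAt t).continuousAt

theorem continuous' (h : IsFundamental M η η') : Continuous η' :=
  continuous_iff_continuousAt.2 fun t => (h.hasDerivAt' t).continuousAt

theorem hasDerivAt_psi (h : IsFundamental M η η') (t : ℝ) :
    HasDerivAt (fun t => Real.exp (-t) * η t)
      (Real.exp (-t) * η' t - Real.exp (-t) * η t) t := by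
  refine ((hasDerivAt_neg t).exp.mul (h.hasDerivAt t)).congr_deriv ?_
  ring

theorem hasDerivAt_phi (h : IsFundamental M η η') (t : ℝ) :
    HasDerivAt (fun t => Real.exp (-t) * η' t) (-M * (Real.exp (-t) * η t)) t := by
  refine ((hasDerivAt_neg t).exp.mul (h.hasDerivAt' t)).congr_deriv ?_
  ring

theorem hasDerivAt_curve (h : IsFundamental M η η') (hM : M ≠ 0) (t : ℝ) :
    HasDerivAt (curve M η η') (2 * η t) t := by
  refine (((h.hasDerivAt t).const_add 1 |>.sub (h.hasDerivAt' t)).const_mul (2 / M)).congr_deriv ?_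
  field_simp
  ring

theorem continuous_curve (h : IsFundamental M η η') (hM : M ≠ 0) : Continuous (curve M η η') :=
  continuous_iff_continuousAt.2 fun t => (h.hasDerivAt_curve hM t).continuousAt

theorem curve_zero (h : IsFundamental M η η') : curve M η η' 0 = 0 := by
  simp [curve, h.zero, h.one]

theorem curve_eq (hM : M ≠ 0) (t : ℝ) : M * curve M η η' t = 2 * (1 + η t - η' t) := by
  unfold curve
  field_simp

/-- Running the backward trajectory forwards again: the addition formula for `curve`. -/
theorem curve_sub (h : IsFundamental M η η') (hM : M ≠ 0) (τ t : ℝ) :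
    curve M η η' (τ - t) = 2 / M * (1 - Real.exp (-t) * η' t) +
      curve M η η' τ * (Real.exp (-t) * η' t) - 2 * η τ * (Real.exp (-t) * η t) := by
  have hneg : ∀ t : ℝ, HasDerivAt (fun t => τ - t) (-1) t := fun t => by
    simpa using (hasDerivAt_id t).const_sub τ
  have hy : ∀ t, HasDerivAt (fun t => 2 / M * (1 - Real.exp (-t) * η' t) +
      curve M η η' τ * (Real.exp (-t) * η' t) - 2 * η τ * (Real.exp (-t) * η t)
        - curve M η η' (τ - t))
      (2 * (Real.exp (-t) * η t) - M * curve M η η' τ * (Real.exp (-t) * η t)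
        - 2 * η τ * (Real.exp (-t) * η' t - Real.exp (-t) * η t) + 2 * η (τ - t)) t := fun t => by
    refine (((((h.hasDerivAt_phi t).const_sub 1).const_mul (2 / M)).add
      ((h.hasDerivAt_phi t).const_mul (curve M η η' τ))).sub
      ((h.hasDerivAt_psi t).const_mul (2 * η τ)) |>.sub
      ((h.hasDerivAt_curve hM (τ - t)).comp t (hneg t))).congr_deriv ?_
    field_simp
    ring
  have hv : ∀ t, HasDerivAt (fun t => 2 * (Real.exp (-t) * η t)
        - M * curve M η η' τ * (Real.exp (-t) * η t)
        - 2 * η τ * (Real.exp (-t) * η' t - Real.exp (-t) * η t) + 2 * η (τ - t))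
      (2 * (Real.exp (-t) * η' t - Real.exp (-t) * η t)
        - M * curve M η η' τ * (Real.exp (-t) * η' t - Real.exp (-t) * η t)
        - 2 * η τ * (-M * (Real.exp (-t) * η t) -
            (Real.exp (-t) * η' t - Real.exp (-t) * η t)) - 2 * η' (τ - t)) t := fun t => by
    refine (((((h.hasDerivAt_psi t).const_mul 2).sub
      ((h.hasDerivAt_psi t).const_mul (M * curve M η η' τ))).sub
      (((h.hasDerivAt_phi t).sub (h.hasDerivAt_psi t)).const_mul (2 * η τ))).add
      (((h.hasDerivAt (τ - t)).comp t (hneg t)).const_mul 2)).congr_deriv ?_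
    ring
  have := eq_zero_of_second_order (c := -|t|) (d := |t|) (K := 1 + |M|) (s := 0)
    (by positivity) (fun t _ => (hy t).continuousAt.continuousWithinAt)
    (fun t _ => (hv t).continuousAt.continuousWithinAt) (fun t _ => hy t) (fun t _ => hv t)
    ?_ ⟨by simp, by simp⟩ (by simp [h.zero, h.one]) (by simp [h.zero, h.one]) t
    ⟨neg_abs_le t, le_abs_self t⟩
  · linarith [this.1]
  · intro t _
    apply abs_le_of_eq_damped
    have e := curve_eq (η := η) (η' := η') hM (τ - t)
    have e2 : M * (2 / M * (1 - Real.exp (-t) * η' t)) = 2 * (1 - Real.exp (-t) * η' t) := by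
      field_simp
    linear_combination e2 - e

theorem jac_zero (h : IsFundamental M η η') (r d : ℝ) : jac M η η' r d 0 = 1 := by
  simp [jac, h.zero, h.one]

theorem continuous_jac (h : IsFundamental M η η') :
    Continuous fun p : ℝ × ℝ × ℝ => jac M η η' p.1 p.2.1 p.2.2 := by
  have := h.continuous
  have := h.continuous'
  unfold jac
  fun_prop

/-- Relative to the backward trajectory through the same density, the Jacobian is that trajectory run
forwards plus the excess of the velocity gradient. -/
theorem jac_eq (h : IsFundamental M η η') (hM : M ≠ 0) {r d τ : ℝ} (hr : r * curve M η η' τ = 1)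
    (t : ℝ) : jac M η η' r d t =
      r * curve M η η' (τ - t) + (d + r * (2 * η τ)) * (Real.exp (-t) * η t) := by
  rw [h.curve_sub hM, jac]
  linear_combination (-(Real.exp (-t) * η' t)) * hr

section Subcritical

theorem eta_pos (hη : ∀ t, 0 ≤ t → t ≤ η t) {t : ℝ} (ht : 0 < t) : 0 < η t :=
  ht.trans_le (hη t ht.le)

theorem sq_le_curve (h : IsFundamental M η η') (hM : M ≠ 0) (hη : ∀ t, 0 ≤ t → t ≤ η t) {t : ℝ}
    (ht : 0 ≤ t) : t ^ 2 ≤ curve M η η' t := by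
  have hmono : MonotoneOn (fun t => curve M η η' t - t ^ 2) (Ici 0) := by
    have hd : ∀ t : ℝ, HasDerivAt (fun t => curve M η η' t - t ^ 2) (2 * η t - 2 * t) t := fun t =>
      ((h.hasDerivAt_curve hM t).sub (hasDerivAt_pow 2 t)).congr_deriv (by norm_num)
    refine monotoneOn_of_deriv_nonneg (convex_Ici 0)
      (fun t _ => (hd t).continuousAt.continuousWithinAt)
      (fun t _ => (hd t).differentiableAt.differentiableWithinAt) fun t ht => ?_
    rw [(hd t).deriv]
    rw [interior_Ici] at ht
    linarith [hη t (le_of_lt ht)]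
  have := hmono self_mem_Ici ht ht
  simp only [h.curve_zero] at this
  linarith

theorem strictMonoOn_curve (h : IsFundamental M η η') (hM : M ≠ 0) {b : Set ℝ} (hb : Convex ℝ b)
    (hη : ∀ t ∈ interior b, 0 < η t) : StrictMonoOn (curve M η η') b :=
  strictMonoOn_of_deriv_pos hb (h.continuous_curve hM).continuousOn fun t ht => by
    rw [(h.hasDerivAt_curve hM t).deriv]
    linarith [hη t ht]

theorem curve_nonneg (h : IsFundamental M η η') (hM : M ≠ 0) (hη : ∀ t, 0 ≤ t → t ≤ η t)
    (hη' : ∀ t < 0, η t < 0) (t : ℝ) : 0 ≤ curve M η η' t := by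
  rcases le_total 0 t with ht | ht
  · exact (sq_nonneg t).trans (h.sq_le_curve hM hη ht)
  · have : AntitoneOn (curve M η η') (Iic 0) :=
      antitoneOn_of_deriv_nonpos (convex_Iic 0) (h.continuous_curve hM).continuousOn
        (fun t _ => (h.hasDerivAt_curve hM t).differentiableAt.differentiableWithinAt)
        fun t ht => by
          rw [interior_Iic] at ht
          rw [(h.hasDerivAt_curve hM t).deriv]
          linarith [hη' t ht]
    have := this ht self_mem_Iic ht
    rwa [h.curve_zero] at this

theorem exists_curve_eq (h : IsFundamental M η η') (hM : M ≠ 0) (hη : ∀ t, 0 ≤ t → t ≤ η t)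
    {σ : ℝ} (hσ : 0 < σ) : ∃ τ, 0 < τ ∧ curve M η η' τ = σ := by
  have h1 : σ ≤ curve M η η' (σ + 1) := by
    have := h.sq_le_curve hM hη (t := σ + 1) (by linarith)
    nlinarith
  obtain ⟨τ, hτ, he⟩ := intermediate_value_Icc (by linarith : (0 : ℝ) ≤ σ + 1)
    (h.continuous_curve hM).continuousOn ⟨by rw [h.curve_zero]; exact hσ.le, h1⟩
  refine ⟨τ, lt_of_le_of_ne hτ.1 ?_, he⟩
  rintro rfl
  rw [h.curve_zero] at he
  exact hσ.ne he

/-- The Jacobian stays positive exactly when the initial point of phase space lies above the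
trajectory that reaches `s = 0` at rest: that trajectory gives the first term of `jac_eq`, which
vanishes at `t = τ`. -/
theorem jac_pos_iff (h : IsFundamental M η η') (hM : M ≠ 0) (hη : ∀ t, 0 ≤ t → t ≤ η t)
    (hη' : ∀ t < 0, η t < 0) {r d τ : ℝ} (hτ : 0 < τ) (hr : r * curve M η η' τ = 1) :
    (∀ t, 0 ≤ t → 0 < jac M η η' r d t) ↔ -r * (2 * η τ) < d := by
  have hs := h.curve_nonneg hM hη hη'
  have hr0 : 0 < r := by
    by_contra! hr'
    nlinarith [hs τ]
  constructor
  · intro H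
    have := H τ hτ.le
    rw [h.jac_eq hM hr, sub_self, h.curve_zero, mul_zero, zero_add] at this
    have h2 : 0 < Real.exp (-τ) * η τ := mul_pos (Real.exp_pos _) (eta_pos hη hτ)
    linarith [pos_of_mul_pos_left this h2.le]
  · intro hd t ht
    rcases ht.eq_or_lt with rfl | ht
    · rw [h.jac_zero]
      exact one_pos
    · rw [h.jac_eq hM hr]
      have h1 := mul_nonneg hr0.le (hs (τ - t))
      have h2 : 0 < Real.exp (-t) * η t := mul_pos (Real.exp_pos _) (eta_pos hη ht)
      have h3 : 0 < d + r * (2 * η τ) := by linarith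
      have := mul_pos h3 h2
      linarith

theorem eta_le_curve (h : IsFundamental M η η') (hM0 : 0 < M)
    (hη : ∀ t, 0 ≤ t → t ≤ η t) (hη' : ∀ t < 0, η t < 0) {t : ℝ} (ht : 1 ≤ t) :
    2 * η t ≤ 3 * curve M η η' t := by
  have hM := hM0.ne'
  have hanti : Antitone fun t => 2 * η t - curve M η η' t - 2 * t := by
    have hd : ∀ t : ℝ, HasDerivAt (fun t => 2 * η t - curve M η η' t - 2 * t)
        (2 * η' t - 2 * η t - 2 * 1) t := fun t =>
      (((h.hasDerivAt t).const_mul 2).sub (h.hasDerivAt_curve hM t)).sub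
        ((hasDerivAt_id t).const_mul 2)
    refine antitone_of_deriv_nonpos (fun t => (hd t).differentiableAt) fun t => ?_
    rw [(hd t).deriv]
    have := curve_eq (η := η) (η' := η') hM t
    have := mul_nonneg hM0.le (h.curve_nonneg hM hη hη' t)
    linarith
  have h1 := hanti (by linarith : (0 : ℝ) ≤ t)
  simp only [h.zero, h.curve_zero] at h1
  have h2 := h.sq_le_curve hM hη (by linarith : 0 ≤ t)
  nlinarith

/-- At low density the Jacobian is bounded below on bounded time intervals, because the backward
trajectory grows at most like `e^{3 τ}` once `τ ≥ 1`. -/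
theorem exp_le_jac (h : IsFundamental M η η') (hM0 : 0 < M)
    (hη : ∀ t, 0 ≤ t → t ≤ η t) (hη' : ∀ t < 0, η t < 0) {r d τ t : ℝ}
    (hr : r * curve M η η' τ = 1) (hd : -r * (2 * η τ) < d) (ht : 0 ≤ t) (hτ : t + 1 ≤ τ) :
    Real.exp (-3 * t) ≤ jac M η η' r d t := by
  have hM := hM0.ne'
  have hs := h.curve_nonneg hM hη hη'
  have hr0 : 0 < r := by
    by_contra! hr'
    nlinarith [hs τ]
  have hanti : AntitoneOn (fun t => curve M η η' t * Real.exp (-3 * t)) (Ici 1) := by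
    have hd : ∀ t : ℝ, HasDerivAt (fun t => curve M η η' t * Real.exp (-3 * t))
        ((2 * η t - 3 * curve M η η' t) * Real.exp (-3 * t)) t := fun t => by
      refine ((h.hasDerivAt_curve hM t).mul ((hasDerivAt_id t).const_mul (-3)).exp).congr_deriv ?_
      simp only [id]
      ring
    refine antitoneOn_of_deriv_nonpos (convex_Ici 1)
      (fun t _ => (hd t).continuousAt.continuousWithinAt)
      (fun t _ => (hd t).differentiableAt.differentiableWithinAt) fun t ht => ?_
    rw [interior_Ici] at ht
    rw [(hd t).deriv]
    have := h.eta_le_curve hM0 hη hη' (le_of_lt ht)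
    exact mul_nonpos_of_nonpos_of_nonneg (by linarith) (Real.exp_pos _).le
  have h1 := hanti (a := τ - t) (b := τ) (by simp only [mem_Ici]; linarith)
    (by simp only [mem_Ici]; linarith) (by linarith)
  simp only at h1
  have h2 : curve M η η' τ * Real.exp (-3 * t) ≤ curve M η η' (τ - t) := by
    have e : Real.exp (-3 * (τ - t)) = Real.exp (-3 * τ) / Real.exp (-3 * t) := by
      rw [← Real.exp_sub]; ring_nf
    rw [e, mul_div_assoc', le_div_iff₀ (Real.exp_pos _)] at h1
    have := Real.exp_pos (-3 * τ)
    by_contra! hcon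
    nlinarith
  rw [h.jac_eq hM hr]
  have h3 : 0 ≤ (d + r * (2 * η τ)) * (Real.exp (-t) * η t) :=
    mul_nonneg (by linarith) (mul_nonneg (Real.exp_pos _).le (ht.trans (hη t ht)))
  have h4 : r * (curve M η η' τ * Real.exp (-3 * t)) ≤ r * curve M η η' (τ - t) := by gcongr
  rw [← mul_assoc, hr, one_mul] at h4
  linarith

end Subcritical

end IsFundamental

/-! ### The threshold curves -/

/-- Two branches of the same sign agree: near `0` their squared distance decreases because `g > 0`
there, and past that point the equation is regular. -/
theorem IsBranch.eqOn {a s₁ : ℝ} {g : ℝ → ℝ} {J : Set ℝ} {R S : ℝ → ℝ}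
    (hR : IsBranch a g J R) (hS : IsBranch a g J S) (hg : Continuous g) (hs₁ : 0 < s₁)
    (hgpos : ∀ s ∈ Ioo 0 s₁, 0 ≤ g s) (hJ₁ : Icc 0 s₁ ⊆ J) (hJ : J.OrdConnected)
    (hJpos : ∀ s ∈ interior J, 0 < s) (hcl : J ⊆ closure (interior J))
    (hsign : ∀ s ∈ interior J, 0 < R s * S s) : EqOn R S J := by
  have hint : Ioo 0 s₁ ⊆ interior J :=
    interior_maximal (Ioo_subset_Icc_self.trans hJ₁) isOpen_Ioo
  have hd : ∀ s ∈ interior J, HasDerivAt (fun s => (R s - S s) ^ 2)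
      (-(2 * g s / (R s * S s)) * (R s - S s) ^ 2) s := fun s hs => by
    refine (((hR.ode s hs).sub (hS.ode s hs)).pow 2).congr_deriv ?_
    have h1 := hR.ne_zero s hs
    have h2 := hS.ne_zero s hs
    simp only [Pi.sub_apply]
    field_simp
    ring
  have hc : ContinuousOn (fun s => (R s - S s) ^ 2) J :=
    (hR.continuousOn.sub hS.continuousOn).pow 2
  have hnear : ∀ s ∈ Icc 0 s₁, (R s - S s) ^ 2 = 0 := by
    have hanti : AntitoneOn (fun s => (R s - S s) ^ 2) (Icc 0 s₁) := by
      refine antitoneOn_of_deriv_nonpos (convex_Icc 0 s₁) (hc.mono hJ₁) ?_ ?_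
      · rw [interior_Icc]
        exact fun s hs => (hd s (hint hs)).differentiableAt.differentiableWithinAt
      · rw [interior_Icc]
        intro s hs
        rw [(hd s (hint hs)).deriv, neg_mul, neg_nonpos]
        exact mul_nonneg (div_nonneg (by linarith [hgpos s hs]) (hsign s (hint hs)).le)
          (sq_nonneg _)
    intro s hs
    have h := hanti ⟨le_rfl, hs₁.le⟩ hs hs.1
    simp only [hR.zero, hS.zero, sub_self] at h
    exact le_antisymm (by simpa using h) (sq_nonneg _)
  have hmain : EqOn R S (interior J) := by
    intro s hs
    rcases le_or_gt s s₁ with h | h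
    · exact sub_eq_zero.1 (pow_eq_zero_iff two_ne_zero |>.1 (hnear s ⟨(hJpos s hs).le, h⟩))
    · have hsub : Icc (s₁ / 2) s ⊆ interior J :=
        (hJ.interior).out (hint ⟨by linarith, by linarith⟩) hs
      obtain ⟨K, hK⟩ := isCompact_Icc.exists_bound_of_continuousOn
        (f := fun s => 2 * g s / (R s * S s)) (s := Icc (s₁ / 2) s)
        (ContinuousOn.div (by fun_prop) ((hR.continuousOn.mono (hsub.trans interior_subset)).mul
          (hS.continuousOn.mono (hsub.trans interior_subset))) fun x hx => (hsign x (hsub hx)).ne')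
      have := eq_zero_of_abs_deriv_le (K := K) (hc.mono (hsub.trans interior_subset))
        (fun t ht => hd t (hsub (Ioo_subset_Icc_self ht))) (fun t ht => ?_)
        (fun t _ => sq_nonneg (R t - S t)) (s := s₁ / 2) ⟨le_rfl, by linarith⟩
        (hnear _ ⟨by linarith, by linarith⟩) s ⟨by linarith, le_rfl⟩
      · exact sub_eq_zero.1 (pow_eq_zero_iff two_ne_zero |>.1 this)
      · rw [abs_mul, abs_neg, abs_of_nonneg (sq_nonneg (R t - S t))]
        exact mul_le_mul_of_nonneg_right (hK t (Ioo_subset_Icc_self ht)) (sq_nonneg _)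
  exact hmain.of_subset_closure hR.continuousOn hS.continuousOn interior_subset hcl

theorem IsUpperBranch.eqOn_Ici {M : ℝ} (hM : 0 < M) {R S : ℝ → ℝ}
    (hR : IsUpperBranch M (Ici 0) R) (hS : IsUpperBranch M (Ici 0) S) : EqOn R S (Ici 0) := by
  refine hR.1.eqOn hS.1 (by fun_prop) (s₁ := 2 / M) (by positivity) (fun s hs => ?_)
    (fun s hs => hs.1) ordConnected_Ici (fun s hs => by simpa using hs) ?_ fun s hs => ?_
  · have := (lt_div_iff₀ hM).1 hs.2
    linarith
  · rw [interior_Ici, closure_Ioi]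
  · have hs' := interior_subset hs
    exact mul_pos ((hR.2 s hs').lt_of_ne' (hR.1.ne_zero s hs))
      ((hS.2 s hs').lt_of_ne' (hS.1.ne_zero s hs))

theorem IsUpperBranch.eqOn_Icc {M γ : ℝ} (hM : 0 < M) (hγ : 0 < γ) {R S : ℝ → ℝ}
    (hR : IsUpperBranch M (Icc 0 γ) R) (hS : IsUpperBranch M (Icc 0 γ) S) :
    EqOn R S (Icc 0 γ) := by
  refine hR.1.eqOn hS.1 (by fun_prop) (s₁ := min (2 / M) γ) (lt_min (by positivity) hγ)
    (fun s hs => ?_) (Icc_subset_Icc_right (min_le_right _ _)) ordConnected_Icc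
    (fun s hs => ?_) ?_ fun s hs => ?_
  · have := (lt_div_iff₀ hM).1 (hs.2.trans_le (min_le_left _ _))
    linarith
  · rw [interior_Icc] at hs
    exact hs.1
  · rw [interior_Icc, closure_Ioo hγ.ne]
  · have hs' := interior_subset hs
    exact mul_pos ((hR.2 s hs').lt_of_ne' (hR.1.ne_zero s hs))
      ((hS.2 s hs').lt_of_ne' (hS.1.ne_zero s hs))

theorem IsLowerBranch.eqOn {M γ : ℝ} (hM : 0 < M) (hγ : 2 / M < γ) {R S : ℝ → ℝ}
    (hR : IsLowerBranch M γ R) (hS : IsLowerBranch M γ S) :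
    EqOn R S (Icc 0 γ) := by
  have hγ0 : 0 < γ := lt_trans (by positivity) hγ
  refine hR.1.eqOn hS.1 (by fun_prop) (s₁ := γ - 2 / M) (by linarith)
    (fun s hs => ?_) (Icc_subset_Icc_right (by linarith [div_pos two_pos hM])) ordConnected_Icc
    (fun s hs => ?_) ?_ fun s hs => ?_
  · have := (div_lt_iff₀ hM).1 (show 2 / M < γ - s by linarith [hs.2])
    linarith
  · rw [interior_Icc] at hs
    exact hs.1
  · rw [interior_Icc, closure_Ioo hγ0.ne]
  · have hs' := interior_subset hs
    exact mul_pos_of_neg_of_neg ((hR.2 s hs').lt_of_ne (hR.1.ne_zero s hs))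
      ((hS.2 s hs').lt_of_ne (hS.1.ne_zero s hs))

/-- A strictly increasing unbounded parametrization of a half-line has a left inverse that is
continuous on the whole line. -/
theorem exists_continuous_leftInverse_Ici {c : ℝ → ℝ} (hc : Continuous c)
    (hmono : StrictMonoOn c (Ici 0)) (htop : Tendsto c atTop atTop) :
    ∃ T : ℝ → ℝ, Continuous T ∧ ∀ τ, 0 ≤ τ → T (c τ) = τ := by
  have hp : StrictMono fun τ => min τ 0 + c (max τ 0) := by
    intro x y hxy
    rcases lt_or_ge x 0 with hx | hx
    · have h1 : min x 0 < min y 0 := by rw [min_eq_left hx.le]; exact lt_min hxy hx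
      have h2 : c (max x 0) ≤ c (max y 0) :=
        hmono.monotoneOn (mem_Ici.2 (le_max_right _ _)) (mem_Ici.2 (le_max_right _ _)) (max_le_max_right _ hxy.le)
      simp only
      linarith
    · have h2 : c x < c y := hmono hx (hx.trans hxy.le) hxy
      simp only
      rwa [min_eq_right hx, min_eq_right (hx.trans hxy.le), max_eq_left hx,
        max_eq_left (hx.trans hxy.le), zero_add, zero_add]
  have hpc : Continuous fun τ => min τ 0 + c (max τ 0) := by fun_prop
  have h1 : Tendsto (fun τ => min τ 0 + c (max τ 0)) atTop atTop := by
    refine htop.congr' ?_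
    filter_upwards [eventually_ge_atTop 0] with τ hτ
    rw [min_eq_right hτ, max_eq_left hτ, zero_add]
  have h2 : Tendsto (fun τ => min τ 0 + c (max τ 0)) atBot atBot := by
    refine (tendsto_atBot_add_const_right atBot (c 0) tendsto_id).congr' ?_
    filter_upwards [eventually_le_atBot 0] with τ hτ
    rw [min_eq_left hτ, max_eq_right hτ, id]
  have hsurj := hpc.surjective h1 h2
  set e := hp.orderIsoOfSurjective _ hsurj with he
  refine ⟨e.symm, e.symm.continuous, fun τ hτ => ?_⟩
  rw [OrderIso.symm_apply_eq, he, StrictMono.coe_orderIsoOfSurjective, min_eq_right hτ,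
    max_eq_left hτ, zero_add]

theorem exists_continuous_leftInverse_Icc {c : ℝ → ℝ} {b : ℝ} (hb : 0 ≤ b) (hc : Continuous c)
    (hmono : StrictMonoOn c (Icc 0 b)) :
    ∃ T : ℝ → ℝ, Continuous T ∧ ∀ τ ∈ Icc 0 b, T (c τ) = τ := by
  have h1 : StrictMonoOn (fun τ => c (min τ b) + max (τ - b) 0) (Ici 0) := by
    intro x hx y hy hxy
    have hx0 : 0 ≤ x := hx
    have hy0 : 0 ≤ y := hy
    simp only
    rcases lt_or_ge x b with h | h
    · have h1 : c (min x b) < c (min y b) := by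
        refine hmono ⟨le_min hx0 hb, min_le_right _ _⟩ ⟨le_min hy0 hb, min_le_right _ _⟩ ?_
        rw [min_eq_left h.le]
        exact lt_min hxy h
      have : max (x - b) 0 ≤ max (y - b) 0 := max_le_max_right _ (by linarith)
      linarith
    · rw [min_eq_right h, min_eq_right (h.trans hxy.le), max_eq_left (by linarith),
        max_eq_left (by linarith)]
      linarith
  have h2 : Tendsto (fun τ => c (min τ b) + max (τ - b) 0) atTop atTop := by
    refine (tendsto_atTop_add_const_left atTop (c b - b) tendsto_id).congr' ?_
    filter_upwards [eventually_ge_atTop b] with τ hτ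
    rw [min_eq_right hτ, max_eq_left (by linarith), id]
    ring
  obtain ⟨T, hT, h⟩ := exists_continuous_leftInverse_Ici (by fun_prop) h1 h2
  refine ⟨T, hT, fun τ hτ => ?_⟩
  have := h τ hτ.1
  rwa [min_eq_left hτ.2, max_eq_right (by linarith [hτ.2]), add_zero] at this

/-- A branch in parametric form, `R (c τ) = q τ`; here `T` is a left inverse of the parametrization
`c`. -/
theorem isBranch_comp {a : ℝ} {g : ℝ → ℝ} {I J : Set ℝ} {c q c' q' T : ℝ → ℝ} (hT : Continuous T)
    (hTc : ∀ τ ∈ I, T (c τ) = τ) (hsurj : ∀ s ∈ J, ∃ τ ∈ I, c τ = s)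
    (h0 : 0 ∈ I) (hc0 : c 0 = 0) (hq0 : q 0 = 0) (hc : ∀ τ, HasDerivAt c (c' τ) τ)
    (hq : ∀ τ, HasDerivAt q (q' τ) τ)
    (hne : ∀ τ ∈ I, c τ ∈ interior J → q τ ≠ 0 ∧ c' τ ≠ 0 ∧
      q' τ * (c' τ)⁻¹ = a + 1 / q τ * g (c τ)) : IsBranch a g J (q ∘ T) := by
  have hqc : Continuous q := continuous_iff_continuousAt.2 fun t => (hq t).continuousAt
  refine ⟨(hqc.comp hT).continuousOn, ?_, fun s hs => ?_, fun s hs => ?_⟩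
  · have := hTc 0 h0
    rw [hc0] at this
    rw [Function.comp_apply, this, hq0]
  · obtain ⟨τ, hτ, rfl⟩ := hsurj s (interior_subset hs)
    rw [Function.comp_apply, hTc τ hτ]
    exact (hne τ hτ hs).1
  · have hloc : ∀ᶠ y in 𝓝 s, c (T y) = y := by
      filter_upwards [mem_interior_iff_mem_nhds.1 hs] with y hy
      obtain ⟨τ, hτ, rfl⟩ := hsurj y hy
      rw [hTc τ hτ]
    obtain ⟨τ, hτ, rfl⟩ := hsurj s (interior_subset hs)
    have hTτ := hTc τ hτ
    have hd : HasDerivAt T (c' τ)⁻¹ (c τ) :=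
      HasDerivAt.of_local_left_inverse hT.continuousAt (by rw [hTτ]; exact hc τ)
        (hne τ hτ hs).2.1 hloc
    have hqd : HasDerivAt q (q' τ) (T (c τ)) := by rw [hTτ]; exact hq τ
    refine (hqd.comp (c τ) hd).congr_deriv ?_
    rw [(hne τ hτ hs).2.2, Function.comp_apply, hTτ]

theorem IsFundamental.exists_isUpperBranch_Ici {M : ℝ} {η η' : ℝ → ℝ} (h : IsFundamental M η η')
    (hM : M ≠ 0) (hη : ∀ t, 0 ≤ t → t ≤ η t) :
    ∃ R, IsUpperBranch M (Ici 0) R ∧ ∀ τ, 0 ≤ τ → R (curve M η η' τ) = 2 * η τ := by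
  have hmono : StrictMonoOn (curve M η η') (Ici 0) :=
    h.strictMonoOn_curve hM (convex_Ici 0) fun t ht => by
      rw [interior_Ici] at ht
      exact eta_pos hη ht
  have htop : Tendsto (curve M η η') atTop atTop := by
    refine tendsto_atTop_mono' atTop ?_ (tendsto_pow_atTop two_ne_zero)
    filter_upwards [eventually_ge_atTop 0] with t ht
    exact h.sq_le_curve hM hη ht
  obtain ⟨T, hT, hTc⟩ := exists_continuous_leftInverse_Ici (h.continuous_curve hM) hmono htop
  have hsurj : ∀ s ∈ Ici (0 : ℝ), ∃ τ ∈ Ici (0 : ℝ), curve M η η' τ = s := fun s hs => by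
    rcases (show (0 : ℝ) ≤ s from hs).eq_or_lt with rfl | hs
    · exact ⟨0, self_mem_Ici, h.curve_zero⟩
    · obtain ⟨τ, hτ, he⟩ := h.exists_curve_eq hM hη hs
      exact ⟨τ, hτ.le, he⟩
  refine ⟨(fun τ => 2 * η τ) ∘ T, ⟨?_, fun s hs => ?_⟩, fun τ hτ => ?_⟩
  · refine isBranch_comp (c := curve M η η') (c' := fun τ => 2 * η τ) (q' := fun τ => 2 * η' τ) hT
      hTc hsurj self_mem_Ici h.curve_zero (by simp [h.zero]) (h.hasDerivAt_curve hM)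
      (fun τ => (h.hasDerivAt τ).const_mul 2) fun τ hτ hs => ?_
    rw [interior_Ici] at hs
    have hτ0 : 0 < τ := lt_of_le_of_ne hτ fun e => by
      rw [← e, h.curve_zero] at hs
      exact lt_irrefl (0 : ℝ) hs
    have hpos := eta_pos hη hτ0
    refine ⟨by positivity, by positivity, ?_⟩
    have := curve_eq (η := η) (η' := η') hM τ
    simp only [this]
    field_simp
    ring
  · obtain ⟨τ, hτ, rfl⟩ := hsurj s hs
    rw [Function.comp_apply, hTc τ hτ]
    have := hη τ hτ
    have : (0 : ℝ) ≤ τ := hτ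
    linarith
  · rw [Function.comp_apply, hTc τ hτ]

theorem two_div_lt_gammaStar {M : ℝ} (hM : 0 < M) : 2 / M < gammaStar M := by
  unfold gammaStar
  have : 0 < 2 / M := by positivity
  nlinarith [Real.exp_pos (Real.pi / Real.sqrt (4 * M - 1))]

/-- The supercritical backward trajectory rises from `s = 0` to `s = γ` during the first half-period
and falls below `s = 0` during the second one; these two arcs are the graphs of `R₁` and `R₂`. -/
theorem exists_branches_of_gt {M : ℝ} (hM : 1 / 4 < M) :
    (∃ R, IsUpperBranch M (Icc 0 (gammaStar M)) R) ∧ ∃ R, IsLowerBranch M (gammaStar M) R := by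
  have hM0 : 0 < M := by linarith
  have h := isFundamental_of_gt hM
  set ω := Real.sqrt (M - 1 / 4) with hω
  have hω0 : 0 < ω := Real.sqrt_pos.2 (by linarith)
  set η : ℝ → ℝ := fun t => Real.exp (t / 2) * (Real.sin (ω * t) / ω) with hη
  set η' : ℝ → ℝ := fun t =>
    Real.exp (t / 2) * (Real.sin (ω * t) / ω / 2 + Real.cos (ω * t)) with hη'
  set b := Real.pi / ω with hb
  have hb0 : 0 < b := by positivity
  have hωb : ω * b = Real.pi := by rw [hb]; field_simp
  have hγ : curve M η η' b = gammaStar M := by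
    have e1 : b / 2 = Real.pi / Real.sqrt (4 * M - 1) := by
      have : Real.sqrt (4 * M - 1) = 2 * ω := by
        rw [show 4 * M - 1 = 2 ^ 2 * (M - 1 / 4) by ring, Real.sqrt_mul (by norm_num),
          Real.sqrt_sq (by norm_num)]
      rw [this, hb]
      field_simp
    simp only [curve, hη, hη', hωb, Real.sin_pi, Real.cos_pi, gammaStar, e1]
    ring
  have hηb : η b = 0 := by simp [hη, hωb]
  have hpos : ∀ t ∈ Ioo 0 b, 0 < η t := fun t ht => by
    refine mul_pos (Real.exp_pos _) (div_pos (Real.sin_pos_of_pos_of_lt_pi ?_ ?_) hω0)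
    · exact mul_pos hω0 ht.1
    · rw [← hωb]
      exact mul_lt_mul_of_pos_left ht.2 hω0
  have hneg : ∀ t ∈ Ioo 0 b, η (b + t) < 0 := fun t ht => by
    refine mul_neg_of_pos_of_neg (Real.exp_pos _) (div_neg_of_neg_of_pos ?_ hω0)
    rw [mul_add, hωb, add_comm, Real.sin_add_pi, neg_lt_zero]
    refine Real.sin_pos_of_pos_of_lt_pi (mul_pos hω0 ht.1) ?_
    rw [← hωb]
    exact mul_lt_mul_of_pos_left ht.2 hω0
  have hM' := hM0.ne'
  have hγ0 : 0 < gammaStar M := lt_trans (by positivity) (two_div_lt_gammaStar hM0)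
  constructor
  · have hmono : StrictMonoOn (curve M η η') (Icc 0 b) :=
      h.strictMonoOn_curve hM' (convex_Icc 0 b) (by rwa [interior_Icc])
    obtain ⟨T, hT, hTc⟩ := exists_continuous_leftInverse_Icc hb0.le (h.continuous_curve hM') hmono
    have hsurj : ∀ s ∈ Icc 0 (gammaStar M), ∃ τ ∈ Icc 0 b, curve M η η' τ = s := fun s hs =>
      intermediate_value_Icc hb0.le (h.continuous_curve hM').continuousOn
        (by rwa [hγ, h.curve_zero])
    refine ⟨(fun τ => 2 * η τ) ∘ T, ?_, fun s hs => ?_⟩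
    · refine isBranch_comp (c := curve M η η') (c' := fun τ => 2 * η τ) (q' := fun τ => 2 * η' τ)
        hT hTc hsurj ⟨le_rfl, hb0.le⟩ h.curve_zero (by simp [h.zero]) (h.hasDerivAt_curve hM')
        (fun τ => (h.hasDerivAt τ).const_mul 2) fun τ hτ hs => ?_
      rw [interior_Icc] at hs
      have hτ0 : 0 < τ := lt_of_le_of_ne hτ.1 fun e => by
        rw [← e, h.curve_zero] at hs
        exact lt_irrefl _ hs.1
      have hτb : τ < b := lt_of_le_of_ne hτ.2 fun e => by
        rw [e, hγ] at hs
        exact lt_irrefl _ hs.2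
      have hpos := hpos τ ⟨hτ0, hτb⟩
      refine ⟨by positivity, by positivity, ?_⟩
      have := IsFundamental.curve_eq (η := η) (η' := η') hM' τ
      simp only [this]
      field_simp
      ring
    · obtain ⟨τ, hτ, rfl⟩ := hsurj s hs
      rw [Function.comp_apply, hTc τ hτ]
      refine mul_nonneg two_pos.le (mul_nonneg (Real.exp_pos _).le (div_nonneg ?_ hω0.le))
      refine Real.sin_nonneg_of_nonneg_of_le_pi (mul_nonneg hω0.le hτ.1) ?_
      rw [← hωb]
      exact mul_le_mul_of_nonneg_left hτ.2 hω0.le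
  · have hadd : ∀ t : ℝ, HasDerivAt (fun t => b + t) 1 t := fun t =>
      (hasDerivAt_id t).const_add b
    have hcd : ∀ τ, HasDerivAt (fun τ => gammaStar M - curve M η η' (b + τ))
        (-(2 * η (b + τ))) τ := fun τ => by
      refine (((h.hasDerivAt_curve hM' (b + τ)).comp τ (hadd τ)).const_sub (gammaStar M)).congr_deriv
        ?_
      ring
    have hcc : Continuous fun τ => gammaStar M - curve M η η' (b + τ) :=
      continuous_iff_continuousAt.2 fun t => (hcd t).continuousAt
    have hc0 : gammaStar M - curve M η η' (b + 0) = 0 := by rw [add_zero, hγ, sub_self]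
    have hcb : gammaStar M ≤ gammaStar M - curve M η η' (b + b) := by
      have e2 : ω * (b + b) = 2 * Real.pi := by rw [mul_add, hωb]; ring
      have : curve M η η' (b + b) = 2 / M * (1 - Real.exp b) := by
        simp only [curve, hη, hη', e2, Real.sin_two_pi, Real.cos_two_pi]
        rw [show (b + b) / 2 = b by ring]
        ring
      rw [this]
      have h1 : 1 ≤ Real.exp b := Real.one_le_exp hb0.le
      have h2 : 0 < 2 / M := by positivity
      nlinarith
    have hmono : StrictMonoOn (fun τ => gammaStar M - curve M η η' (b + τ)) (Icc 0 b) :=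
      strictMonoOn_of_deriv_pos (convex_Icc 0 b) hcc.continuousOn fun t ht => by
        rw [interior_Icc] at ht
        rw [(hcd t).deriv]
        linarith [hneg t ht]
    obtain ⟨T, hT, hTc⟩ := exists_continuous_leftInverse_Icc hb0.le hcc hmono
    have hsurj : ∀ s ∈ Icc 0 (gammaStar M),
        ∃ τ ∈ Icc 0 b, gammaStar M - curve M η η' (b + τ) = s := fun s hs =>
      intermediate_value_Icc hb0.le hcc.continuousOn
        (by rw [hc0]; exact ⟨hs.1, hs.2.trans hcb⟩)
    refine ⟨(fun τ => 2 * η (b + τ)) ∘ T, ?_, fun s hs => ?_⟩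
    · refine isBranch_comp (c := fun τ => gammaStar M - curve M η η' (b + τ))
        (c' := fun τ => -(2 * η (b + τ))) (q' := fun τ => 2 * η' (b + τ))
        hT hTc hsurj ⟨le_rfl, hb0.le⟩ hc0 (by simp [hηb]) hcd
        (fun τ => ?_) fun τ hτ hs => ?_
      · refine (((h.hasDerivAt (b + τ)).comp τ (hadd τ)).const_mul 2).congr_deriv ?_
        ring
      · rw [interior_Icc] at hs
        have hτ0 : 0 < τ := lt_of_le_of_ne hτ.1 fun e => by
          rw [← e, hc0] at hs
          exact lt_irrefl _ hs.1
        have hτb : τ < b := lt_of_le_of_ne hτ.2 fun e => by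
          rw [e] at hs
          exact absurd hs.2 (not_lt.2 hcb)
        have hneg := hneg τ ⟨hτ0, hτb⟩
        have hne := hneg.ne
        refine ⟨by simpa using hne, by simpa using hne, ?_⟩
        have := IsFundamental.curve_eq (η := η) (η' := η') hM' (b + τ)
        simp only [sub_sub_cancel, this]
        field_simp
        ring
    · obtain ⟨τ, hτ, rfl⟩ := hsurj s hs
      rw [Function.comp_apply, hTc τ hτ]
      refine mul_nonpos_of_nonneg_of_nonpos two_pos.le
        (mul_nonpos_of_nonneg_of_nonpos (Real.exp_pos _).le (div_nonpos_of_nonpos_of_nonneg ?_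
          hω0.le))
      rw [mul_add, hωb, add_comm, Real.sin_add_pi, neg_nonpos]
      refine Real.sin_nonneg_of_nonneg_of_le_pi (mul_nonneg hω0.le hτ.1) ?_
      rw [← hωb]
      exact mul_le_mul_of_nonneg_left hτ.2 hω0.le

/-! ### Decay and the nonlocal force -/

/-- The decay `σ = O((1 + |x|)^{-(2+δ)})` with an explicit constant. -/
def DecaysWith (δ C : ℝ) (σ : ℝ → ℝ) : Prop := ∀ x, |σ x| ≤ C * (1 + |x|) ^ (-(2 + δ))

theorem integrable_weight {δ : ℝ} (hδ : 0 < δ) :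
    Integrable fun x : ℝ => (1 + |x|) ^ (-(1 + δ)) := by
  have := integrable_one_add_norm (E := ℝ) (μ := volume) (r := 1 + δ) (by simp [hδ])
  simpa only [Real.norm_eq_abs] using this

theorem one_add_abs_mul_weight (δ x : ℝ) :
    (1 + |x|) * (1 + |x|) ^ (-(2 + δ)) = (1 + |x|) ^ (-(1 + δ)) := by
  have h : 0 < 1 + |x| := by positivity
  calc _ = (1 + |x|) ^ (1 : ℝ) * (1 + |x|) ^ (-(2 + δ)) := by rw [Real.rpow_one]
    _ = _ := by
      rw [← Real.rpow_add h]
      congr 1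
      ring

theorem weight_le_one {δ : ℝ} (hδ : 0 < δ) (x : ℝ) : (1 + |x|) ^ (-(2 + δ)) ≤ 1 :=
  Real.rpow_le_one_of_one_le_of_nonpos (by linarith [abs_nonneg x]) (by linarith)

theorem DecaysWith.nonneg {δ C : ℝ} {σ : ℝ → ℝ} (h : DecaysWith δ C σ) : 0 ≤ C := by
  have := (abs_nonneg _).trans (h 0)
  simpa using this

theorem DecaysWith.abs_le {δ C : ℝ} (hδ : 0 < δ) {σ : ℝ → ℝ} (h : DecaysWith δ C σ) (x : ℝ) :
    |σ x| ≤ C :=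
  (h x).trans (mul_le_of_le_one_right h.nonneg (weight_le_one hδ x))

theorem DecaysWith.abs_mul_le {δ C A : ℝ} {σ f : ℝ → ℝ} (h : DecaysWith δ C σ) (hA : 0 ≤ A)
    (hf : ∀ x, |f x| ≤ A * (1 + |x|)) (x : ℝ) :
    |f x * σ x| ≤ A * C * (1 + |x|) ^ (-(1 + δ)) := by
  rw [abs_mul, ← one_add_abs_mul_weight]
  calc |f x| * |σ x| ≤ A * (1 + |x|) * (C * (1 + |x|) ^ (-(2 + δ))) := by
        gcongr
        · exact hf x
        · exact h x
    _ = _ := by ring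

theorem DecaysWith.integrable_mul {δ C A : ℝ} (hδ : 0 < δ) {σ f : ℝ → ℝ} (h : DecaysWith δ C σ)
    (hσ : Continuous σ) (hfm : AEStronglyMeasurable f) (hA : 0 ≤ A)
    (hf : ∀ x, |f x| ≤ A * (1 + |x|)) : Integrable fun x => f x * σ x :=
  ((integrable_weight hδ).const_mul (A * C)).mono' (hfm.mul hσ.aestronglyMeasurable)
    (Eventually.of_forall fun x => h.abs_mul_le hA hf x)

theorem DecaysWith.integrable {δ C : ℝ} (hδ : 0 < δ) {σ : ℝ → ℝ} (h : DecaysWith δ C σ)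
    (hσ : Continuous σ) : Integrable σ := by
  simpa using h.integrable_mul (f := fun _ => 1) (A := 1) hδ hσ aestronglyMeasurable_const
    zero_le_one (fun x => by simp)

theorem DecaysWith.integrable_id_mul {δ C : ℝ} (hδ : 0 < δ) {σ : ℝ → ℝ} (h : DecaysWith δ C σ)
    (hσ : Continuous σ) : Integrable fun x => x * σ x :=
  h.integrable_mul (f := fun x => x) (A := 1) hδ hσ aestronglyMeasurable_id
    zero_le_one (fun x => by linarith)

theorem measurable_sign : Measurable Real.sign := by
  unfold Real.sign
  exact Measurable.ite measurableSet_Iio measurable_const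
    (Measurable.ite measurableSet_Ioi measurable_const measurable_const)

theorem abs_sign_le (x : ℝ) : |Real.sign x| ≤ 1 := by
  rcases Real.sign_apply_eq x with h | h | h <;> simp [h]

theorem abs_dW_sub_le (x y : ℝ) : |dW (x - y)| ≤ (1 + |x|) * (1 + |y|) := by
  unfold dW
  calc _ ≤ |-Real.sign (x - y)| + |x - y| := abs_add_le _ _
    _ ≤ 1 + (|x| + |y|) := by
      rw [abs_neg]
      exact add_le_add (abs_sign_le _) (abs_sub _ _)
    _ ≤ _ := by nlinarith [mul_nonneg (abs_nonneg x) (abs_nonneg y)]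

theorem measurable_dW_sub (x : ℝ) : Measurable fun y => dW (x - y) := by
  unfold dW
  exact ((measurable_sign.comp (measurable_const.sub measurable_id)).neg).add
    (measurable_const.sub measurable_id)

theorem integral_sign_mul {σ : ℝ → ℝ} (hσ : Integrable σ) (x : ℝ) :
    ∫ y, Real.sign (x - y) * σ y = 2 * (∫ y in Iic x, σ y) - ∫ y, σ y := by
  have h : (fun y => Real.sign (x - y) * σ y) =
      fun y => (Iio x).indicator σ y - (Ioi x).indicator σ y := by
    funext y
    rcases lt_trichotomy y x with hy | rfl | hy
    · rw [Real.sign_of_pos (by linarith), indicator_of_mem (mem_Iio.2 hy),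
        indicator_of_notMem (by simp [hy.le])]
      ring
    · simp
    · rw [Real.sign_of_neg (by linarith), indicator_of_notMem (by simp [hy.le]),
        indicator_of_mem (mem_Ioi.2 hy)]
      ring
  rw [h, integral_sub (hσ.indicator measurableSet_Iio) (hσ.indicator measurableSet_Ioi),
    integral_indicator measurableSet_Iio, integral_indicator measurableSet_Ioi,
    ← integral_Iic_eq_integral_Iio, ← intervalIntegral.integral_Iic_add_Ioi (b := x)
      hσ.integrableOn hσ.integrableOn]
  ring

theorem integrable_sign_mul {σ : ℝ → ℝ} (hσ : Integrable σ) (x : ℝ) :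
    Integrable fun y => Real.sign (x - y) * σ y :=
  hσ.bdd_mul (c := 1) (measurable_sign.comp
    (measurable_const.sub measurable_id)).aestronglyMeasurable
    (Eventually.of_forall fun _ => abs_sign_le _)

theorem dWConv_eq {σ : ℝ → ℝ} (hσ : Integrable σ) (hσ' : Integrable fun y => y * σ y) (x : ℝ) :
    dWConv σ x = (∫ y, σ y) - 2 * (∫ y in Iic x, σ y) + x * (∫ y, σ y) - ∫ y, y * σ y := by
  have h : (fun y => dW (x - y) * σ y) =
      fun y => (x * σ y - y * σ y) - Real.sign (x - y) * σ y := by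
    funext y
    unfold dW
    ring
  have h1 : Integrable fun y => x * σ y - y * σ y := (hσ.const_mul x).sub hσ'
  rw [dWConv, h, integral_sub h1 (integrable_sign_mul hσ x),
    integral_sub (hσ.const_mul x) hσ', integral_const_mul, integral_sign_mul hσ]
  ring

theorem dWConv_sub_dWConv {σ : ℝ → ℝ} (hσ : Integrable σ) (hσ' : Integrable fun y => y * σ y)
    (x x' : ℝ) : dWConv σ x - dWConv σ x' = (x - x') * (∫ y, σ y) - 2 * ∫ y in x'..x, σ y := by
  rw [dWConv_eq hσ hσ', dWConv_eq hσ hσ',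
    ← intervalIntegral.integral_Iic_sub_Iic hσ.integrableOn hσ.integrableOn]
  ring

/-- Change of variables in the nonlocal term along an increasing Lagrangian map `X` that transports
the density `σ₀` to `σ`. -/
theorem integral_comp_transport {X J σ σ₀ : ℝ → ℝ} (hmono : StrictMono X)
    (hsurj : Function.Surjective X) (hX : ∀ α, HasDerivAt X (J α) α) (hJ : ∀ α, 0 < J α)
    (hσ : ∀ α, σ (X α) * J α = σ₀ α) (g : ℝ → ℝ) :
    ∫ y, g y * σ y = ∫ α, g (X α) * σ₀ α := by
  have := integral_image_eq_integral_abs_deriv_smul MeasurableSet.univ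
    (fun x _ => (hX x).hasDerivWithinAt) hmono.injective.injOn (fun y => g y * σ y)
  rw [image_univ, hsurj.range_eq, setIntegral_univ, setIntegral_univ] at this
  rw [this]
  congr 1
  funext α
  rw [abs_of_pos (hJ α), smul_eq_mul, ← hσ α]
  ring

theorem sign_sub_of_strictMono {X : ℝ → ℝ} (hmono : StrictMono X) (α β : ℝ) :
    Real.sign (X α - X β) = Real.sign (α - β) := by
  rcases lt_trichotomy α β with h | rfl | h
  · rw [Real.sign_of_neg (by linarith [hmono h]), Real.sign_of_neg (by linarith)]
  · simp
  · rw [Real.sign_of_pos (by linarith [hmono h]), Real.sign_of_pos (by linarith)]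

theorem dWConv_transport {X J σ σ₀ : ℝ → ℝ} (hmono : StrictMono X)
    (hsurj : Function.Surjective X) (hX : ∀ α, HasDerivAt X (J α) α) (hJ : ∀ α, 0 < J α)
    (hσ : ∀ α, σ (X α) * J α = σ₀ α) (α : ℝ) :
    dWConv σ (X α) = ∫ β, (-Real.sign (α - β) + (X α - X β)) * σ₀ β := by
  rw [dWConv, integral_comp_transport hmono hsurj hX hJ hσ]
  congr 1
  funext β
  rw [dW, sign_sub_of_strictMono hmono]

/-- Spatial Lipschitz continuity of the nonlocal term. -/
theorem DecaysWith.abs_dWConv_sub_le {δ C : ℝ} (hδ : 0 < δ) {σ : ℝ → ℝ} (h : DecaysWith δ C σ)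
    (hσ : Continuous σ) (x y : ℝ) :
    |dWConv σ x - dWConv σ y| ≤
      C * ((∫ z : ℝ, (1 + |z|) ^ (-(1 + δ))) + 2) * |x - y| := by
  have hi := h.integrable hδ hσ
  rw [dWConv_sub_dWConv hi (h.integrable_id_mul hδ hσ)]
  have h1 : |∫ z, σ z| ≤ C * ∫ z : ℝ, (1 + |z|) ^ (-(1 + δ)) := by
    rw [← integral_const_mul, ← Real.norm_eq_abs]
    refine norm_integral_le_of_norm_le ((integrable_weight hδ).const_mul C)
      (Eventually.of_forall fun z => ?_)
    simpa using h.abs_mul_le (f := fun _ => 1) (A := 1) zero_le_one (fun x => by simp) z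
  have h2 : |∫ z in y..x, σ z| ≤ C * |x - y| := by
    rw [← Real.norm_eq_abs]
    exact intervalIntegral.norm_integral_le_of_norm_le_const fun z _ => h.abs_le hδ z
  calc _ ≤ |(x - y) * ∫ z, σ z| + |2 * ∫ z in y..x, σ z| := abs_sub _ _
    _ = |x - y| * |∫ z, σ z| + 2 * |∫ z in y..x, σ z| := by rw [abs_mul, abs_mul, abs_two]
    _ ≤ |x - y| * (C * ∫ z : ℝ, (1 + |z|) ^ (-(1 + δ))) + 2 * (C * |x - y|) := by gcongr
    _ = _ := by ring

/-- Continuity in time of the nonlocal term, by dominated convergence. -/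
theorem continuousOn_dWConv {δ C : ℝ} (hδ : 0 < δ) {ρ : ℝ → ℝ → ℝ} {S : Set ℝ}
    (hdec : ∀ t ∈ S, DecaysWith δ C fun y => ρ y t) (hρx : ∀ t ∈ S, Continuous fun y => ρ y t)
    (hρt : ∀ y, ContinuousOn (ρ y) S) (x : ℝ) :
    ContinuousOn (fun t => dWConv (fun y => ρ y t) x) S := by
  unfold dWConv
  refine continuousOn_of_dominated
    (bound := fun y => (1 + |x|) * C * (1 + |y|) ^ (-(1 + δ))) (fun t ht => ?_) (fun t ht => ?_)
    ((integrable_weight hδ).const_mul _) (Eventually.of_forall fun y => ?_)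
  · exact (measurable_dW_sub x).aestronglyMeasurable.mul (hρx t ht).aestronglyMeasurable
  · exact Eventually.of_forall fun y =>
      (hdec t ht).abs_mul_le (by positivity) (abs_dW_sub_le x) y
  · exact continuousOn_const.mul (hρt y)

/-- A bounded function of order `|x|^{-(2+δ)}` decays. -/
theorem decaysWith_of_abs_rpow_le {δ A B : ℝ} (hδ : 0 < δ) {σ : ℝ → ℝ} (hB0 : 0 ≤ B)
    (hA : ∀ x, |x| ^ (2 + δ) * |σ x| ≤ A) (hB : ∀ x, |x| ≤ 1 → |σ x| ≤ B) :
    DecaysWith δ (2 ^ (2 + δ) * (A + B)) σ := by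
  intro x
  have hx : 0 < 1 + |x| := by positivity
  have hA0 : 0 ≤ A := le_trans (by positivity) (hA 0)
  rw [Real.rpow_neg hx.le, ← div_eq_mul_inv, le_div_iff₀ (by positivity)]
  rcases le_total |x| 1 with h | h
  · calc |σ x| * (1 + |x|) ^ (2 + δ) ≤ B * 2 ^ (2 + δ) := by
          gcongr
          · exact hB x h
          · linarith
      _ ≤ _ := by
        have : (0 : ℝ) ≤ 2 ^ (2 + δ) * A := by positivity
        linarith
  · calc |σ x| * (1 + |x|) ^ (2 + δ) ≤ |σ x| * (2 * |x|) ^ (2 + δ) := by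
          gcongr
          linarith
      _ = 2 ^ (2 + δ) * (|x| ^ (2 + δ) * |σ x|) := by
          rw [Real.mul_rpow two_pos.le (abs_nonneg x)]
          ring
      _ ≤ 2 ^ (2 + δ) * (A + B) := by
          gcongr
          linarith [hA x]

/-! ### Characteristics of a global solution -/

section Regularity

variable {f : ℝ → ℝ → ℝ}

theorem halfPlane_mem_nhds {x t : ℝ} (ht : 0 < t) : (univ : Set ℝ) ×ˢ Ici (0 : ℝ) ∈ 𝓝 (x, t) :=
  prod_mem_nhds univ_mem (Ici_mem_nhds ht)

theorem differentiableAt_of_halfPlane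
    (hf : ContDiffOn ℝ 1 (fun p : ℝ × ℝ => f p.1 p.2) (univ ×ˢ Ici 0)) {x t : ℝ} (ht : 0 < t) :
    DifferentiableAt ℝ (fun p : ℝ × ℝ => f p.1 p.2) (x, t) :=
  (hf.contDiffAt (halfPlane_mem_nhds ht)).differentiableAt one_ne_zero

theorem hasDerivAt_comp_curve {L : ℝ × ℝ →L[ℝ] ℝ} {a b : ℝ → ℝ} {a' b' s : ℝ}
    (hf : HasFDerivAt (fun p : ℝ × ℝ => f p.1 p.2) L (a s, b s)) (ha : HasDerivAt a a' s)
    (hb : HasDerivAt b b' s) : HasDerivAt (fun s => f (a s) (b s)) (L (a', b')) s :=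
  HasFDerivAt.comp_hasDerivAt (f := fun s => (a s, b s)) s hf (ha.prodMk hb)

/-- Chain rule along a space-time curve, in terms of the partial derivatives. -/
theorem hasDerivAt_along
    (hf : ContDiffOn ℝ 1 (fun p : ℝ × ℝ => f p.1 p.2) (univ ×ˢ Ici 0)) {Y : ℝ → ℝ} {y' t : ℝ}
    (ht : 0 < t) (hY : HasDerivAt Y y' t) :
    HasDerivAt (fun s => f (Y s) s)
      (deriv (fun y => f y t) (Y t) * y' + deriv (fun s => f (Y t) s) t) t := by
  have hd := (differentiableAt_of_halfPlane hf (x := Y t) ht).hasFDerivAt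
  set A := fderiv ℝ (fun p : ℝ × ℝ => f p.1 p.2) (Y t, t) with hA
  have hx : HasDerivAt (fun y => f y t) (A (1, 0)) (Y t) :=
    hasDerivAt_comp_curve hd (hasDerivAt_id (Y t)) (hasDerivAt_const (Y t) t)
  have hs : HasDerivAt (fun s => f (Y t) s) (A (0, 1)) t :=
    hasDerivAt_comp_curve hd (hasDerivAt_const t (Y t)) (hasDerivAt_id t)
  have h := hasDerivAt_comp_curve hd hY (hasDerivAt_id t)
  refine h.congr_deriv ?_
  rw [hx.deriv, hs.deriv, show ((y', 1) : ℝ × ℝ) = y' • ((1, 0) : ℝ × ℝ) + (0, 1) by simp,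
    map_add, map_smul, smul_eq_mul]
  ring

theorem hasDerivAt_space
    (hf : ContDiffOn ℝ 1 (fun p : ℝ × ℝ => f p.1 p.2) (univ ×ˢ Ici 0)) {t : ℝ} (ht : 0 < t)
    (x : ℝ) : HasDerivAt (fun y => f y t) (deriv (fun y => f y t) x) x :=
  (hasDerivAt_comp_curve (differentiableAt_of_halfPlane hf (x := x) ht).hasFDerivAt
    (hasDerivAt_id x) (hasDerivAt_const x t)).differentiableAt.hasDerivAt

theorem continuous_space (hf : ContDiffOn ℝ 1 (fun p : ℝ × ℝ => f p.1 p.2) (univ ×ˢ Ici 0))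
    {t : ℝ} (ht : 0 ≤ t) : Continuous fun y => f y t :=
  hf.continuousOn.comp_continuous (f := fun y : ℝ => (y, t)) (by fun_prop)
    fun _ => ⟨mem_univ _, ht⟩

theorem continuousOn_along (hf : ContDiffOn ℝ 1 (fun p : ℝ × ℝ => f p.1 p.2) (univ ×ˢ Ici 0))
    {Y : ℝ → ℝ} {S : Set ℝ} (hS : ∀ t ∈ S, 0 ≤ t) (hY : ContinuousOn Y S) :
    ContinuousOn (fun t => f (Y t) t) S :=
  hf.continuousOn.comp (f := fun t => (Y t, t)) (hY.prodMk continuousOn_id)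
    fun t ht => ⟨mem_univ _, hS t ht⟩

theorem continuousOn_partial_space
    (hf : ContDiffOn ℝ 1 (fun p : ℝ × ℝ => f p.1 p.2) (univ ×ˢ Ici 0)) :
    ContinuousOn (fun p : ℝ × ℝ => deriv (fun y => f y p.2) p.1) (univ ×ˢ Ioi 0) := by
  have h := (hf.mono (prod_mono_right Ioi_subset_Ici_self)).continuousOn_fderiv_of_isOpen
    (isOpen_univ.prod isOpen_Ioi) le_rfl
  refine (h.clm_apply (continuousOn_const (c := ((1, 0) : ℝ × ℝ)))).congr fun p hp => ?_
  have hd := (differentiableAt_of_halfPlane hf (x := p.1) hp.2).hasFDerivAt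
  exact (hasDerivAt_comp_curve hd (hasDerivAt_id p.1) (hasDerivAt_const p.1 p.2)).deriv

theorem continuousOn_partial_time
    (hf : ContDiffOn ℝ 1 (fun p : ℝ × ℝ => f p.1 p.2) (univ ×ˢ Ici 0)) :
    ContinuousOn (fun p : ℝ × ℝ => deriv (fun s => f p.1 s) p.2) (univ ×ˢ Ioi 0) := by
  have h := (hf.mono (prod_mono_right Ioi_subset_Ici_self)).continuousOn_fderiv_of_isOpen
    (isOpen_univ.prod isOpen_Ioi) le_rfl
  refine (h.clm_apply (continuousOn_const (c := ((0, 1) : ℝ × ℝ)))).congr fun p hp => ?_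
  have hd := (differentiableAt_of_halfPlane hf (x := p.1) hp.2).hasFDerivAt
  exact (hasDerivAt_comp_curve hd (hasDerivAt_const p.2 p.1) (hasDerivAt_id p.2)).deriv

/-- Since `f` is `C¹` up to `t = 0`, its spatial derivative is bounded along a curve over `[0, T]`
even though the curve reaches the boundary. -/
theorem exists_bound_partial_along
    (hf : ContDiffOn ℝ 1 (fun p : ℝ × ℝ => f p.1 p.2) (univ ×ˢ Ici 0)) {Y : ℝ → ℝ} {T : ℝ}
    (hY : ContinuousOn Y (Icc 0 T)) :
    ∃ K, ∀ t ∈ Ioo 0 T, |deriv (fun y => f y t) (Y t)| ≤ K := by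
  have hu : UniqueDiffOn ℝ ((univ : Set ℝ) ×ˢ Ici (0 : ℝ)) :=
    uniqueDiffOn_univ.prod (uniqueDiffOn_Ici 0)
  have h1 := hf.continuousOn_fderivWithin hu le_rfl
  have h2 : ContinuousOn (fun t => fderivWithin ℝ (fun p : ℝ × ℝ => f p.1 p.2)
      (univ ×ˢ Ici 0) (Y t, t) ((1, 0) : ℝ × ℝ)) (Icc 0 T) :=
    (h1.comp (f := fun t => (Y t, t)) (hY.prodMk continuousOn_id)
      fun t ht => ⟨mem_univ _, ht.1⟩).clm_apply continuousOn_const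
  obtain ⟨K, hK⟩ := isCompact_Icc.exists_bound_of_continuousOn h2
  refine ⟨K, fun t ht => ?_⟩
  have h3 := hK t (Ioo_subset_Icc_self ht)
  rw [fderivWithin_of_mem_nhds (halfPlane_mem_nhds ht.1)] at h3
  have hd := (differentiableAt_of_halfPlane hf (x := Y t) ht.1).hasFDerivAt
  have h4 : HasDerivAt (fun y => f y t) (fderiv ℝ (fun p : ℝ × ℝ => f p.1 p.2) (Y t, t) (1, 0))
      (Y t) := hasDerivAt_comp_curve hd (hasDerivAt_id (Y t)) (hasDerivAt_const (Y t) t)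
  rw [h4.deriv]
  exact h3

end Regularity

/-- A characteristic of the flow over `[0, T]`: a curve that moves with the velocity `u`, and along
which `u` obeys Newton's law with damping and the nonlocal force. -/
structure IsCharacteristic (ρ u : ℝ → ℝ → ℝ) (T : ℝ) (Y : ℝ → ℝ) : Prop where
  continuousOn : ContinuousOn Y (Icc 0 T)
  continuousOn_velocity : ContinuousOn (fun t => u (Y t) t) (Icc 0 T)
  hasDerivAt : ∀ t ∈ Ioo 0 T, HasDerivAt Y (u (Y t) t) t
  hasDerivAt_velocity : ∀ t ∈ Ioo 0 T,
    HasDerivAt (fun t => u (Y t) t) (-u (Y t) t - dWConv (fun y => ρ y t) (Y t)) t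

namespace IsGlobalSolution

variable {δ : ℝ} {ρ₀ u₀ : ℝ → ℝ} {ρ u : ℝ → ℝ → ℝ}

theorem exists_decaysWith (h : IsGlobalSolution δ ρ₀ u₀ ρ u) (hδ : 0 < δ) {T : ℝ} (hT : 0 < T) :
    ∃ C, ∀ t ∈ Icc 0 T, DecaysWith δ C fun y => ρ y t := by
  obtain ⟨A, hA⟩ := h.density_decay (T + 1) (by linarith)
  obtain ⟨B, hB⟩ := (isCompact_Icc.prod isCompact_Icc).exists_bound_of_continuousOn
    (s := Icc (-1 : ℝ) 1 ×ˢ Icc 0 T)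
    (h.contDiff_density.continuousOn.mono fun p hp => ⟨mem_univ _, hp.2.1⟩)
  have hB0 : 0 ≤ B := (norm_nonneg _).trans (hB (0, 0) ⟨by simp, by simp [hT.le]⟩)
  refine ⟨2 ^ (2 + δ) * (A + B), fun t ht => decaysWith_of_abs_rpow_le hδ hB0
    (fun x => hA x t ht.1 (by linarith [ht.2])) fun x hx => hB (x, t) ⟨abs_le.1 hx, ht⟩⟩

theorem integrable (h : IsGlobalSolution δ ρ₀ u₀ ρ u) (hδ : 0 < δ) {t : ℝ} (ht : 0 ≤ t) :
    Integrable fun y => ρ y t := by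
  obtain ⟨C, hC⟩ := h.exists_decaysWith hδ (T := t + 1) (by linarith)
  exact (hC t ⟨ht, by linarith⟩).integrable hδ (continuous_space h.contDiff_density ht)

theorem integrable_id_mul (h : IsGlobalSolution δ ρ₀ u₀ ρ u) (hδ : 0 < δ) {t : ℝ} (ht : 0 ≤ t) :
    Integrable fun y => y * ρ y t := by
  obtain ⟨C, hC⟩ := h.exists_decaysWith hδ (T := t + 1) (by linarith)
  exact (hC t ⟨ht, by linarith⟩).integrable_id_mul hδ (continuous_space h.contDiff_density ht)

theorem exists_lipschitz_force (h : IsGlobalSolution δ ρ₀ u₀ ρ u) (hδ : 0 < δ) {T : ℝ}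
    (hT : 0 < T) : ∃ K, 0 ≤ K ∧ ∀ t ∈ Icc 0 T, ∀ x y,
      |-dWConv (fun y => ρ y t) x - -dWConv (fun y => ρ y t) y| ≤ K * |x - y| := by
  obtain ⟨C, hC⟩ := h.exists_decaysWith hδ hT
  have hC0 : 0 ≤ C := (hC 0 ⟨le_rfl, hT.le⟩).nonneg
  refine ⟨C * ((∫ z : ℝ, (1 + |z|) ^ (-(1 + δ))) + 2), mul_nonneg hC0 (add_nonneg
    (integral_nonneg fun z => by positivity) two_pos.le), fun t ht x y => ?_⟩
  rw [neg_sub_neg, abs_sub_comm]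
  exact (hC t ht).abs_dWConv_sub_le hδ (continuous_space h.contDiff_density ht.1) x y

/-- Through every point of space-time passes a characteristic defined on all of `[0, T]`. The curve
is built from Newton's law, whose force is globally Lipschitz; the difference between its velocity
and the value of `u` on it solves a homogeneous linear equation and hence vanishes. -/
theorem exists_characteristic (h : IsGlobalSolution δ ρ₀ u₀ ρ u) (hδ : 0 < δ) {T t₀ : ℝ}
    (hT : 0 < T) (ht₀ : t₀ ∈ Icc 0 T) (x₀ : ℝ) : ∃ Y, IsCharacteristic ρ u T Y ∧ Y t₀ = x₀ := by
  obtain ⟨C, hC⟩ := h.exists_decaysWith hδ hT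
  obtain ⟨K, hK0, hK⟩ := h.exists_lipschitz_force hδ hT
  have hcont : ∀ x, ContinuousOn (fun t => -dWConv (fun y => ρ y t) x) (Icc 0 T) := fun x =>
    (continuousOn_dWConv hδ hC (fun t ht => continuous_space h.contDiff_density ht.1)
      (fun y => continuousOn_along h.contDiff_density (fun t ht => ht.1) continuousOn_const) x).neg
  obtain ⟨Y, V, hY0, hV0, hYc, hVc, hY, hV⟩ :=
    exists_second_order_solution (H := fun x t => -dWConv (fun y => ρ y t) x) hT.le hK0 hK hcont
      ht₀ x₀ (u x₀ t₀)
  have huc : ContinuousOn (fun t => u (Y t) t) (Icc 0 T) :=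
    continuousOn_along h.contDiff_velocity (fun t ht => ht.1) hYc
  have hu : ∀ t ∈ Ioo 0 T, HasDerivAt (fun t => u (Y t) t - V t)
      (-(1 + deriv (fun y => u y t) (Y t)) * (u (Y t) t - V t)) t := fun t ht => by
    refine ((hasDerivAt_along h.contDiff_velocity ht.1 (hY t ht)).sub (hV t ht)).congr_deriv ?_
    linear_combination h.momentum_eq (Y t) t ht.1
  obtain ⟨B, hB⟩ := exists_bound_partial_along h.contDiff_velocity hYc
  have hz := eq_zero_of_abs_deriv_le (E := fun t => (u (Y t) t - V t) ^ 2)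
    (E' := fun t => -2 * (1 + deriv (fun y => u y t) (Y t)) * (u (Y t) t - V t) ^ 2)
    (a := 0) (b := T) (K := 2 * (1 + B)) ((huc.sub hVc).pow 2)
    (fun t ht => ((hu t ht).pow 2).congr_deriv (by norm_num; ring)) (fun t ht => ?_)
    (fun t _ => sq_nonneg _) ht₀ (by rw [hY0, hV0]; simp)
  · have he : ∀ t ∈ Icc 0 T, u (Y t) t = V t := fun t ht =>
      sub_eq_zero.1 (pow_eq_zero_iff two_ne_zero |>.1 (hz t ht))
    refine ⟨Y, ⟨hYc, huc, fun t ht => ?_, fun t ht => ?_⟩, hY0⟩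
    · rw [he t (Ioo_subset_Icc_self ht)]
      exact hY t ht
    · refine ((hV t ht).congr_of_eventuallyEq ?_).congr_deriv ?_
      · filter_upwards [Icc_mem_nhds ht.1 ht.2] with s hs using he s hs
      · rw [he t (Ioo_subset_Icc_self ht)]
        ring
  · rw [abs_mul, abs_of_nonneg (sq_nonneg (u (Y t) t - V t)), abs_mul]
    refine mul_le_mul_of_nonneg_right ?_ (sq_nonneg _)
    rw [show |(-2 : ℝ)| = 2 by norm_num]
    refine mul_le_mul_of_nonneg_left ((abs_add_le _ _).trans ?_) two_pos.le
    rw [abs_one]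
    linarith [hB t ht]

theorem _root_.Aggregation.IsCharacteristic.eqOn (h : IsGlobalSolution δ ρ₀ u₀ ρ u) (hδ : 0 < δ)
    {T t₀ : ℝ} (hT : 0 < T) (ht₀ : t₀ ∈ Icc 0 T) {Y Z : ℝ → ℝ} (hY : IsCharacteristic ρ u T Y)
    (hZ : IsCharacteristic ρ u T Z) (h0 : Y t₀ = Z t₀) : EqOn Y Z (Icc 0 T) := by
  obtain ⟨K, hK0, hK⟩ := h.exists_lipschitz_force hδ hT
  have := eq_zero_of_second_order (y := fun t => Y t - Z t)
    (v := fun t => u (Y t) t - u (Z t) t) (K := 1 + K) (by positivity)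
    (hY.continuousOn.sub hZ.continuousOn) (hY.continuousOn_velocity.sub hZ.continuousOn_velocity)
    (fun t ht => (hY.hasDerivAt t ht).sub (hZ.hasDerivAt t ht))
    (fun t ht => (hY.hasDerivAt_velocity t ht).sub (hZ.hasDerivAt_velocity t ht))
    (fun t ht => ?_) ht₀ (by simp [h0]) (by simp [h0])
  · exact fun t ht => sub_eq_zero.1 (this t ht).1
  · have h1 := hK t (Ioo_subset_Icc_self ht) (Y t) (Z t)
    have h2 := abs_nonneg (Y t - Z t)
    have h3 := abs_nonneg (u (Y t) t - u (Z t) t)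
    calc _ = |-(u (Y t) t - u (Z t) t) +
          (-dWConv (fun y => ρ y t) (Y t) - -dWConv (fun y => ρ y t) (Z t))| := by
          congr 1
          ring
      _ ≤ |u (Y t) t - u (Z t) t| + K * |Y t - Z t| := by
          refine (abs_add_le _ _).trans ?_
          rw [abs_neg]
          linarith
      _ ≤ _ := by nlinarith

end IsGlobalSolution

/-! ### Conservation of mass between characteristics -/

namespace IsGlobalSolution

variable {δ : ℝ} {ρ₀ u₀ : ℝ → ℝ} {ρ u : ℝ → ℝ → ℝ}

/-- The mass between two characteristics, written over the fixed interval `[0, 1]`, has derivative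
zero: the integrand of the time derivative is the `θ`-derivative of `ρ (ℓ - u)`, where `ℓ`
interpolates the velocities of the endpoints. -/
theorem hasDerivAt_mass_between (h : IsGlobalSolution δ ρ₀ u₀ ρ u) {T t : ℝ} {Y Z : ℝ → ℝ}
    (hY : IsCharacteristic ρ u T Y) (hZ : IsCharacteristic ρ u T Z) (ht : t ∈ Ioo 0 T) :
    HasDerivAt (fun t => ∫ θ in (0 : ℝ)..1, (Z t - Y t) * ρ (Y t + (Z t - Y t) * θ) t) 0 t := by
  let G : ℝ → ℝ → ℝ := fun t θ =>
    (u (Z t) t - u (Y t) t) * ρ (Y t + (Z t - Y t) * θ) t +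
      (Z t - Y t) * (deriv (fun y => ρ y t) (Y t + (Z t - Y t) * θ) *
        (u (Y t) t + (u (Z t) t - u (Y t) t) * θ) +
        deriv (fun s => ρ (Y t + (Z t - Y t) * θ) s) t)
  have hpath : ∀ t ∈ Ioo 0 T, ∀ θ, HasDerivAt (fun t => Y t + (Z t - Y t) * θ)
      (u (Y t) t + (u (Z t) t - u (Y t) t) * θ) t := fun t ht θ =>
    (hY.hasDerivAt t ht).add (((hZ.hasDerivAt t ht).sub (hY.hasDerivAt t ht)).mul_const θ)
  have hFd : ∀ t ∈ Ioo 0 T, ∀ θ, HasDerivAt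
      (fun t => (Z t - Y t) * ρ (Y t + (Z t - Y t) * θ) t) (G t θ) t := fun t ht θ =>
    ((hZ.hasDerivAt t ht).sub (hY.hasDerivAt t ht)).mul
      (hasDerivAt_along h.contDiff_density ht.1 (hpath t ht θ))
  have hsub : Icc (t / 2) ((t + T) / 2) ⊆ Ioo 0 T := fun s hs =>
    ⟨by linarith [hs.1, ht.1], by linarith [hs.2, ht.2]⟩
  have hGc : ContinuousOn (fun p : ℝ × ℝ => G p.1 p.2)
      (Icc (t / 2) ((t + T) / 2) ×ˢ univ) := by
    have c1 : ∀ {f : ℝ → ℝ}, ContinuousOn f (Icc 0 T) →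
        ContinuousOn (fun p : ℝ × ℝ => f p.1) (Icc (t / 2) ((t + T) / 2) ×ˢ (univ : Set ℝ)) :=
      fun hf => hf.comp continuousOn_fst fun p hp => Ioo_subset_Icc_self (hsub hp.1)
    have cY := c1 hY.continuousOn
    have cZ := c1 hZ.continuousOn
    have cYu := c1 hY.continuousOn_velocity
    have cZu := c1 hZ.continuousOn_velocity
    have cz : ContinuousOn (fun p : ℝ × ℝ => (Y p.1 + (Z p.1 - Y p.1) * p.2, p.1))
        (Icc (t / 2) ((t + T) / 2) ×ˢ (univ : Set ℝ)) :=
      (cY.add ((cZ.sub cY).mul continuousOn_snd)).prodMk continuousOn_fst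
    have c2 := h.contDiff_density.continuousOn.comp cz
      fun p hp => ⟨mem_univ _, (hsub hp.1).1.le⟩
    have c3 := (continuousOn_partial_space h.contDiff_density).comp cz
      fun p hp => ⟨mem_univ _, (hsub hp.1).1⟩
    have c4 := (continuousOn_partial_time h.contDiff_density).comp cz
      fun p hp => ⟨mem_univ _, (hsub hp.1).1⟩
    exact ((cZu.sub cYu).mul c2).add ((cZ.sub cY).mul
      ((c3.mul (cYu.add ((cZu.sub cYu).mul continuousOn_snd))).add c4))
  have hGt : Continuous (G t) := by
    refine hGc.comp_continuous (f := fun θ : ℝ => (t, θ)) (by fun_prop) fun θ => ⟨?_, mem_univ _⟩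
    exact ⟨by linarith [ht.1], by linarith [ht.2]⟩
  have hFc : ∀ t ∈ Ioo 0 T, Continuous fun θ => (Z t - Y t) * ρ (Y t + (Z t - Y t) * θ) t :=
    fun t ht => continuous_const.mul
      ((continuous_space h.contDiff_density ht.1.le).comp (by fun_prop))
  obtain ⟨B, hB⟩ := (isCompact_Icc.prod isCompact_Icc).exists_bound_of_continuousOn
    (s := Icc (t / 2) ((t + T) / 2) ×ˢ Icc (0 : ℝ) 1)
    (hGc.mono (prod_mono_right (subset_univ _)))
  have key := (intervalIntegral.hasDerivAt_integral_of_dominated_loc_of_deriv_le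
    (μ := volume) (a := 0) (b := 1) (F' := G) (bound := fun _ => B)
    (s := Icc (t / 2) ((t + T) / 2))
    (Icc_mem_nhds (by linarith [ht.1]) (by linarith [ht.2]))
    (by
      filter_upwards [Ioo_mem_nhds ht.1 ht.2] with s hs
      exact (hFc s hs).aestronglyMeasurable)
    ((hFc t ht).intervalIntegrable 0 1) hGt.aestronglyMeasurable
    (Eventually.of_forall fun θ hθ s hs => hB (s, θ) ⟨hs, by
      rw [uIoc_of_le zero_le_one] at hθ
      exact ⟨hθ.1.le, hθ.2⟩⟩) (by simp)
    (Eventually.of_forall fun θ _ s hs => hFd s (hsub hs) θ)).2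
  refine key.congr_deriv ?_
  have hlin : ∀ θ, HasDerivAt (fun θ => Y t + (Z t - Y t) * θ) (Z t - Y t) θ := fun θ => by
    simpa using ((hasDerivAt_id θ).const_mul (Z t - Y t)).const_add (Y t)
  have hlin' : ∀ θ, HasDerivAt (fun θ => u (Y t) t + (u (Z t) t - u (Y t) t) * θ)
      (u (Z t) t - u (Y t) t) θ := fun θ => by
    simpa using ((hasDerivAt_id θ).const_mul (u (Z t) t - u (Y t) t)).const_add (u (Y t) t)
  have hprim : ∀ θ, HasDerivAt (fun θ => ρ (Y t + (Z t - Y t) * θ) t *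
      (u (Y t) t + (u (Z t) t - u (Y t) t) * θ) -
        ρ (Y t + (Z t - Y t) * θ) t * u (Y t + (Z t - Y t) * θ) t) (G t θ) θ := fun θ => by
    set z := Y t + (Z t - Y t) * θ with hz
    have dρ := hasDerivAt_space h.contDiff_density ht.1 z
    have du := hasDerivAt_space h.contDiff_velocity ht.1 z
    have hflux := (dρ.mul du).deriv
    have hce := h.continuity_eq z t ht.1
    rw [show (fun y => ρ y t * u y t) = (fun y => ρ y t) * fun y => u y t from rfl, hflux] at hce
    have dρ' := dρ.comp θ (hlin θ)
    have du' := du.comp θ (hlin θ)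
    refine ((dρ'.mul (hlin' θ)).sub (dρ'.mul du')).congr_deriv ?_
    simp only [G, Function.comp_apply, ← hz]
    linear_combination (-(Z t - Y t)) * hce
  rw [intervalIntegral.integral_eq_sub_of_hasDerivAt (fun θ _ => hprim θ)
    (hGt.intervalIntegrable 0 1)]
  simp only [mul_one, mul_zero, add_zero, add_sub_cancel]
  ring

theorem mass_between (h : IsGlobalSolution δ ρ₀ u₀ ρ u) {T : ℝ} {Y Z : ℝ → ℝ}
    (hY : IsCharacteristic ρ u T Y) (hZ : IsCharacteristic ρ u T Z) {t : ℝ} (ht : t ∈ Icc 0 T) :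
    ∫ y in Y t..Z t, ρ y t = ∫ y in Y 0..Z 0, ρ₀ y := by
  have h0 : (0 : ℝ) ∈ Icc 0 T := ⟨le_rfl, ht.1.trans ht.2⟩
  have hN : ∀ t, ∫ θ in (0 : ℝ)..1, (Z t - Y t) * ρ (Y t + (Z t - Y t) * θ) t =
      ∫ y in Y t..Z t, ρ y t := fun t => by
    rw [intervalIntegral.integral_const_mul,
      intervalIntegral.mul_integral_comp_add_mul (f := fun y => ρ y t)]
    congr 1 <;> ring
  have hc : ContinuousOn (fun t => ∫ θ in (0 : ℝ)..1, (Z t - Y t) * ρ (Y t + (Z t - Y t) * θ) t)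
      (Icc 0 T) := by
    rw [continuousOn_iff_continuous_domRestrict]
    have cY : Continuous fun p : Icc 0 T × ℝ => Y p.1 :=
      (continuousOn_iff_continuous_domRestrict.1 hY.continuousOn).comp continuous_fst
    have cZ : Continuous fun p : Icc 0 T × ℝ => Z p.1 :=
      (continuousOn_iff_continuous_domRestrict.1 hZ.continuousOn).comp continuous_fst
    refine intervalIntegral.continuous_parametric_intervalIntegral_of_continuous'
      (f := fun (t : Icc 0 T) θ => (Z t - Y t) * ρ (Y t + (Z t - Y t) * θ) t) ?_ 0 1
    refine (cZ.sub cY).mul (h.contDiff_density.continuousOn.comp_continuous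
      (f := fun p : Icc 0 T × ℝ => (Y p.1 + (Z p.1 - Y p.1) * p.2, (p.1 : ℝ))) ?_ ?_)
    · exact (cY.add ((cZ.sub cY).mul continuous_snd)).prodMk
        (continuous_subtype_val.comp continuous_fst)
    · exact fun p => ⟨mem_univ _, p.1.2.1⟩
  have hle : ∀ s ∈ Icc 0 T, ∀ t ∈ Icc 0 T,
      ∫ y in Y t..Z t, ρ y t ≤ ∫ y in Y s..Z s, ρ y s := fun s hs t ht => by
    have := le_mul_exp_of_abs_deriv_le (K := 0) hc
      (fun t ht => h.hasDerivAt_mass_between hY hZ ht) (fun t _ => by simp) hs ht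
    simpa [hN] using this
  rw [le_antisymm (hle 0 h0 t ht) (hle t ht 0 h0)]
  simp only [h.initial_density]

end IsGlobalSolution

/-! ### The Lagrangian form of a global solution, and uniqueness -/

/-- The separation at time `t` of two particles that start from `α` and `β`: the solution of
`D'' + D' + M D = 2 ∫_α^β ρ₀` with the corresponding initial data. -/
noncomputable def separation (M : ℝ) (η η' ρ₀ u₀ : ℝ → ℝ) (α β t : ℝ) : ℝ :=
  (β - α) * (Real.exp (-t) * η' t) + (u₀ β - u₀ α) * (Real.exp (-t) * η t) +
    2 / M * (1 - Real.exp (-t) * η' t) * ∫ y in α..β, ρ₀ y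

theorem hasDerivAt_separation {M : ℝ} {η η' ρ₀ u₀ : ℝ → ℝ} (hρ₀ : Continuous ρ₀)
    (hu₀ : Differentiable ℝ u₀) (α β t : ℝ) :
    HasDerivAt (fun β => separation M η η' ρ₀ u₀ α β t)
      (jac M η η' (ρ₀ β) (deriv u₀ β) t) β := by
  have h1 : HasDerivAt (fun β => ∫ y in α..β, ρ₀ y) (ρ₀ β) β :=
    intervalIntegral.integral_hasDerivAt_right (hρ₀.intervalIntegrable _ _)
      hρ₀.stronglyMeasurable.stronglyMeasurableAtFilter hρ₀.continuousAt
  refine (((((hasDerivAt_id β).sub_const α).mul_const (Real.exp (-t) * η' t)).add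
    (((hu₀ β).hasDerivAt.sub_const (u₀ α)).mul_const (Real.exp (-t) * η t))).add
    (h1.const_mul (2 / M * (1 - Real.exp (-t) * η' t)))).congr_deriv ?_
  unfold jac
  ring

namespace IsGlobalSolution

variable {δ M : ℝ} {ρ₀ u₀ η η' : ℝ → ℝ} {ρ u : ℝ → ℝ → ℝ}

theorem sub_eq_separation (h : IsGlobalSolution δ ρ₀ u₀ ρ u) (hδ : 0 < δ)
    (hη : IsFundamental M η η') (hM : M ≠ 0) {T : ℝ} {Y Z : ℝ → ℝ}
    (hmass : ∀ t ∈ Icc 0 T, ∫ y, ρ y t = M)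
    (hY : IsCharacteristic ρ u T Y) (hZ : IsCharacteristic ρ u T Z) {t : ℝ} (ht : t ∈ Icc 0 T) :
    Z t - Y t = separation M η η' ρ₀ u₀ (Y 0) (Z 0) t := by
  set I := ∫ y in Y 0..Z 0, ρ₀ y with hI
  set a := Z 0 - Y 0 with ha
  set b := u₀ (Z 0) - u₀ (Y 0) with hb
  have hS : ∀ t, HasDerivAt (separation M η η' ρ₀ u₀ (Y 0) (Z 0))
      (a * (-M * (Real.exp (-t) * η t)) + b * (Real.exp (-t) * η' t - Real.exp (-t) * η t) +
        2 * I * (Real.exp (-t) * η t)) t := fun t => by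
    refine ((((hη.hasDerivAt_phi t).const_mul a).add ((hη.hasDerivAt_psi t).const_mul b)).add
      ((((hη.hasDerivAt_phi t).const_sub 1).const_mul (2 / M)).mul_const I)).congr_deriv ?_
    field_simp
  have hS' : ∀ t, HasDerivAt (fun t => a * (-M * (Real.exp (-t) * η t)) +
        b * (Real.exp (-t) * η' t - Real.exp (-t) * η t) + 2 * I * (Real.exp (-t) * η t))
      (a * (-M * (Real.exp (-t) * η' t - Real.exp (-t) * η t)) +
        b * (-M * (Real.exp (-t) * η t) - (Real.exp (-t) * η' t - Real.exp (-t) * η t)) +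
        2 * I * (Real.exp (-t) * η' t - Real.exp (-t) * η t)) t := fun t =>
    (((((hη.hasDerivAt_psi t).const_mul (-M)).const_mul a).add
      (((hη.hasDerivAt_phi t).sub (hη.hasDerivAt_psi t)).const_mul b)).add
      ((hη.hasDerivAt_psi t).const_mul (2 * I)))
  have h0 : (0 : ℝ) ∈ Icc 0 T := ⟨le_rfl, ht.1.trans ht.2⟩
  have := eq_zero_of_second_order (K := 1 + |M|) (by positivity)
    ((hZ.continuousOn.sub hY.continuousOn).sub
      fun t _ => (hS t).continuousAt.continuousWithinAt)
    ((hZ.continuousOn_velocity.sub hY.continuousOn_velocity).sub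
      fun t _ => (hS' t).continuousAt.continuousWithinAt)
    (fun t ht => ((hZ.hasDerivAt t ht).sub (hY.hasDerivAt t ht)).sub (hS t))
    (fun t ht => ((hZ.hasDerivAt_velocity t ht).sub (hY.hasDerivAt_velocity t ht)).sub (hS' t))
    (fun t ht => ?_) h0 ?_ ?_ t ht
  · exact sub_eq_zero.1 this.1
  · apply abs_le_of_eq_damped
    have ht' := Ioo_subset_Icc_self ht
    have e1 := dWConv_sub_dWConv (h.integrable hδ ht'.1) (h.integrable_id_mul hδ ht'.1)
      (Z t) (Y t)
    rw [hmass t ht', h.mass_between hY hZ ht', ← hI] at e1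
    have e2 : M * separation M η η' ρ₀ u₀ (Y 0) (Z 0) t = a * (M * (Real.exp (-t) * η' t)) +
        b * (M * (Real.exp (-t) * η t)) + 2 * (1 - Real.exp (-t) * η' t) * I := by
      unfold separation
      rw [← hI, ← ha, ← hb]
      field_simp
    simp only [Pi.sub_apply]
    linear_combination -e1 - e2
  · simp [separation, hη.zero, hη.one]
  · simp [hη.zero, hη.one, h.initial_velocity, hb]

/-- The Lagrangian description of an arbitrary global solution. The flow map is an increasing
diffeomorphism at every time and its Jacobian is the explicit function `jac`. -/
theorem exists_flow (h : IsGlobalSolution δ ρ₀ u₀ ρ u) (hδ : 0 < δ) (hρ₀ : Continuous ρ₀)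
    (hu₀ : Differentiable ℝ u₀) (hpos : ∀ x, 0 < ρ₀ x) (hη : IsFundamental M η η')
    (hM : M ≠ 0) (hmass : mass ρ₀ = M) {T : ℝ} (hT : 0 < T) :
    ∃ X : ℝ → ℝ → ℝ, (∀ α, X α 0 = α) ∧ (∀ α, IsCharacteristic ρ u T (X α)) ∧
      ∀ t ∈ Icc 0 T, StrictMono (fun α => X α t) ∧ Function.Surjective (fun α => X α t) ∧
        (∀ α, HasDerivAt (fun α => X α t) (jac M η η' (ρ₀ α) (deriv u₀ α) t) α) ∧
        (∀ α, 0 < jac M η η' (ρ₀ α) (deriv u₀ α) t) ∧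
        (∀ α, ρ (X α t) t * jac M η η' (ρ₀ α) (deriv u₀ α) t = ρ₀ α) ∧
        ∀ α, X α t - X 0 t = separation M η η' ρ₀ u₀ 0 α t := by
  have h0 : (0 : ℝ) ∈ Icc 0 T := ⟨le_rfl, hT.le⟩
  choose X hX hX0 using fun α => h.exists_characteristic hδ hT h0 α
  have hmono : ∀ t ∈ Icc 0 T, StrictMono (fun α => X α t) := fun t ht α β hαβ => by
    by_contra! hcon
    have hsub : Icc 0 t ⊆ Icc 0 T := Icc_subset_Icc_right ht.2
    obtain ⟨s, hs, hs0⟩ := intermediate_value_Icc' ht.1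
      (f := fun s => X β s - X α s)
      (((hX β).continuousOn.sub (hX α).continuousOn).mono hsub)
      (show (0 : ℝ) ∈ Icc (X β t - X α t) (X β 0 - X α 0) from
        ⟨by linarith, by rw [hX0, hX0]; linarith⟩)
    have := (hX β).eqOn h hδ hT (hsub hs) (hX α) (sub_eq_zero.1 hs0) h0
    rw [hX0, hX0] at this
    exact hαβ.ne' this
  have hsurj : ∀ t ∈ Icc 0 T, Function.Surjective (fun α => X α t) := fun t ht x => by
    obtain ⟨Y, hY, hYx⟩ := h.exists_characteristic hδ hT ht x
    refine ⟨Y 0, ?_⟩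
    rw [← hYx]
    exact (hX (Y 0)).eqOn h hδ hT h0 hY (hX0 _) ht
  have hi0 : Integrable ρ₀ := by
    have := h.integrable hδ le_rfl
    simpa only [h.initial_density] using this
  have hconst : ∀ t ∈ Icc 0 T, ∫ y, ρ y t = M := fun t ht => by
    have htop : Tendsto (fun α => X α t) atTop atTop :=
      (hmono t ht).monotone.tendsto_atTop_atTop fun b => (hsurj t ht b).imp fun _ e => e.ge
    have hbot : Tendsto (fun α => X α t) atBot atBot :=
      (hmono t ht).monotone.tendsto_atBot_atBot fun b => (hsurj t ht b).imp fun _ e => e.le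
    have l1 := intervalIntegral_tendsto_integral (h.integrable hδ ht.1)
      (hbot.comp tendsto_neg_atTop_atBot) htop
    have l2 := intervalIntegral_tendsto_integral hi0 tendsto_neg_atTop_atBot
      (tendsto_id (x := atTop (α := ℝ)))
    rw [← hmass]
    refine tendsto_nhds_unique l1 (l2.congr fun n => ?_)
    have := h.mass_between (hX (-n)) (hX n) ht
    rw [hX0, hX0] at this
    exact this.symm
  refine ⟨X, hX0, hX, fun t ht => ?_⟩
  have hsep : ∀ α, X α t - X 0 t = separation M η η' ρ₀ u₀ 0 α t := fun α => by
    have := h.sub_eq_separation hδ hη hM hconst (hX 0) (hX α) ht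
    rwa [hX0, hX0] at this
  have hd : ∀ α, HasDerivAt (fun α => X α t) (jac M η η' (ρ₀ α) (deriv u₀ α) t) α := fun α => by
    have := (hasDerivAt_separation (M := M) (η := η) (η' := η') hρ₀ hu₀ 0 α t).add_const (X 0 t)
    refine this.congr_of_eventuallyEq (Eventually.of_forall fun β => ?_)
    simp only
    rw [← hsep]
    ring
  have hρ : ∀ α, ρ (X α t) t * jac M η η' (ρ₀ α) (deriv u₀ α) t = ρ₀ α := fun α => by
    have hc := continuous_space h.contDiff_density ht.1
    have d1 : HasDerivAt (fun b => ∫ y in X 0 t..b, ρ y t) (ρ (X α t) t) (X α t) :=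
      intervalIntegral.integral_hasDerivAt_right (hc.intervalIntegrable _ _)
        hc.stronglyMeasurable.stronglyMeasurableAtFilter hc.continuousAt
    have d2 : HasDerivAt (fun b => ∫ y in (0 : ℝ)..b, ρ₀ y) (ρ₀ α) α :=
      intervalIntegral.integral_hasDerivAt_right (hρ₀.intervalIntegrable _ _)
        hρ₀.stronglyMeasurable.stronglyMeasurableAtFilter hρ₀.continuousAt
    refine (d1.comp α (hd α)).unique (d2.congr_of_eventuallyEq
      (Eventually.of_forall fun β => ?_))
    have := h.mass_between (hX 0) (hX β) ht
    rwa [hX0, hX0] at this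
  refine ⟨hmono t ht, hsurj t ht, hd, fun α => ?_, hρ, hsep⟩
  refine lt_of_le_of_ne ?_ fun e => ?_
  · rw [← (hd α).deriv]
    exact (hmono t ht).monotone.deriv_nonneg
  · have := hρ α
    rw [← e, mul_zero] at this
    exact (hpos α).ne this

/-- Classical global solutions are unique: two Lagrangian flows have the same separations, and the
difference of the two trajectories from the origin solves `Y'' + Y' = 0` with zero data. -/
theorem unique {ρ' u' : ℝ → ℝ → ℝ} (h : IsGlobalSolution δ ρ₀ u₀ ρ u)
    (h' : IsGlobalSolution δ ρ₀ u₀ ρ' u') (hδ : 0 < δ) (hρ₀ : Continuous ρ₀)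
    (hu₀ : Differentiable ℝ u₀) (hpos : ∀ x, 0 < ρ₀ x) (hη : IsFundamental M η η')
    (hM : M ≠ 0) (hmass : mass ρ₀ = M) (x : ℝ) {t : ℝ} (ht : 0 ≤ t) :
    ρ' x t = ρ x t ∧ u' x t = u x t := by
  rcases ht.eq_or_lt with rfl | ht
  · simp [h.initial_density, h.initial_velocity, h'.initial_density, h'.initial_velocity]
  have hT : 0 < t + 1 := by linarith
  have h0 : (0 : ℝ) ∈ Icc 0 (t + 1) := ⟨le_rfl, hT.le⟩
  obtain ⟨X, hX0, hX, hXt⟩ := h.exists_flow hδ hρ₀ hu₀ hpos hη hM hmass hT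
  obtain ⟨X', hX0', hX', hXt'⟩ := h'.exists_flow hδ hρ₀ hu₀ hpos hη hM hmass hT
  have hforce : ∀ s ∈ Icc 0 (t + 1),
      dWConv (fun y => ρ' y s) (X' 0 s) = dWConv (fun y => ρ y s) (X 0 s) := fun s hs => by
    obtain ⟨m, sj, d, j, r, e⟩ := hXt s hs
    obtain ⟨m', sj', d', j', r', e'⟩ := hXt' s hs
    rw [dWConv_transport m sj d j r 0, dWConv_transport m' sj' d' j' r' 0]
    congr 1
    funext β
    have := (e β).trans (e' β).symm
    rw [show X 0 s - X β s = X' 0 s - X' β s by linarith]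
  have horigin : ∀ s ∈ Icc 0 (t + 1), X' 0 s = X 0 s := fun s hs => by
    have := eq_zero_of_second_order (K := 1) zero_le_one
      ((hX' 0).continuousOn.sub (hX 0).continuousOn)
      ((hX' 0).continuousOn_velocity.sub (hX 0).continuousOn_velocity)
      (fun t ht => ((hX' 0).hasDerivAt t ht).sub ((hX 0).hasDerivAt t ht))
      (fun t ht => ((hX' 0).hasDerivAt_velocity t ht).sub ((hX 0).hasDerivAt_velocity t ht))
      (fun t ht => ?_) h0 (by simp [hX0, hX0'])
      (by simp [hX0, hX0', h.initial_velocity, h'.initial_velocity]) s hs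
    · exact sub_eq_zero.1 this.1
    · rw [hforce t (Ioo_subset_Icc_self ht), one_mul]
      calc _ = |u' (X' 0 t) t - u (X 0 t) t| := by
            rw [← abs_neg]
            congr 1
            ring
        _ ≤ _ := le_add_of_nonneg_left (abs_nonneg _)
  have hflow : ∀ α, ∀ s ∈ Icc 0 (t + 1), X' α s = X α s := fun α s hs => by
    obtain ⟨-, -, -, -, -, e⟩ := hXt s hs
    obtain ⟨-, -, -, -, -, e'⟩ := hXt' s hs
    linarith [e α, e' α, horigin s hs]
  have htI : t ∈ Ioo 0 (t + 1) := ⟨ht, by linarith⟩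
  obtain ⟨-, sj, -, j, r, -⟩ := hXt t (Ioo_subset_Icc_self htI)
  obtain ⟨-, -, -, -, r', -⟩ := hXt' t (Ioo_subset_Icc_self htI)
  obtain ⟨α, rfl⟩ := sj x
  have he := hflow α t (Ioo_subset_Icc_self htI)
  constructor
  · have h1 := (r' α).trans (r α).symm
    rw [he] at h1
    exact mul_right_cancel₀ (j α).ne' h1
  · have h1 := (hX' α).hasDerivAt t htI
    rw [he] at h1
    refine (h1.congr_of_eventuallyEq ?_).unique ((hX α).hasDerivAt t htI)
    filter_upwards [Icc_mem_nhds htI.1 htI.2] with s hs using (hflow α s hs).symm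

end IsGlobalSolution

/-! ### The explicit flow -/

/-- The mass to the left of `α` minus the mass to the right of it. -/
noncomputable def netMass (ρ₀ : ℝ → ℝ) (α : ℝ) : ℝ := ∫ β, Real.sign (α - β) * ρ₀ β

/-- The explicit Lagrangian flow map: the solution of
`X'' + X' + M X = netMass + ∫ β ρ₀ + (1 - e^{-t}) ∫ u₀ ρ₀`, `X(0) = α`, `X'(0) = u₀ α`. -/
noncomputable def flowMap (M : ℝ) (η η' ρ₀ u₀ : ℝ → ℝ) (α t : ℝ) : ℝ :=
  Real.exp (-t) * η' t * (α - (∫ β, β * ρ₀ β) / M) +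
    Real.exp (-t) * η t * (u₀ α - (∫ β, u₀ β * ρ₀ β) / M) +
    (1 - Real.exp (-t) * η' t) * (netMass ρ₀ α / M) +
    ((∫ β, β * ρ₀ β) / M + (∫ β, u₀ β * ρ₀ β) / M * (1 - Real.exp (-t)))

/-- The time derivative of `flowMap`. -/
noncomputable def flowVelocity (M : ℝ) (η η' ρ₀ u₀ : ℝ → ℝ) (α t : ℝ) : ℝ :=
  -M * (Real.exp (-t) * η t) * (α - (∫ β, β * ρ₀ β) / M) +
    (Real.exp (-t) * η' t - Real.exp (-t) * η t) * (u₀ α - (∫ β, u₀ β * ρ₀ β) / M) +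
    Real.exp (-t) * η t * netMass ρ₀ α + (∫ β, u₀ β * ρ₀ β) / M * Real.exp (-t)

section NetMass

variable {ρ₀ : ℝ → ℝ}

theorem netMass_sub (hi : Integrable ρ₀) (α β : ℝ) :
    netMass ρ₀ β - netMass ρ₀ α = 2 * ∫ y in α..β, ρ₀ y := by
  rw [netMass, netMass, integral_sign_mul hi, integral_sign_mul hi,
    ← intervalIntegral.integral_Iic_sub_Iic hi.integrableOn hi.integrableOn]
  ring

theorem hasDerivAt_netMass (hi : Integrable ρ₀) (hc : Continuous ρ₀) (α : ℝ) :
    HasDerivAt (netMass ρ₀) (2 * ρ₀ α) α := by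
  have h1 : HasDerivAt (fun β => ∫ y in (0 : ℝ)..β, ρ₀ y) (ρ₀ α) α :=
    intervalIntegral.integral_hasDerivAt_right (hc.intervalIntegrable _ _)
      hc.stronglyMeasurable.stronglyMeasurableAtFilter hc.continuousAt
  refine ((h1.const_mul 2).const_add (netMass ρ₀ 0)).congr_of_eventuallyEq
    (Eventually.of_forall fun β => ?_)
  simp only
  linarith [netMass_sub hi 0 β]

theorem abs_netMass_le (hi : Integrable ρ₀) (hpos : ∀ x, 0 ≤ ρ₀ x) (α : ℝ) :
    |netMass ρ₀ α| ≤ mass ρ₀ := by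
  rw [← Real.norm_eq_abs]
  refine norm_integral_le_of_norm_le hi (Eventually.of_forall fun β => ?_)
  rw [Real.norm_eq_abs, abs_mul, abs_of_nonneg (hpos β)]
  exact mul_le_of_le_one_left (hpos β) (abs_sign_le _)

/-- The self-interaction through the sign kernel exerts no net force. -/
theorem integral_netMass_mul (hi : Integrable ρ₀) (hc : Continuous ρ₀) :
    ∫ α, netMass ρ₀ α * ρ₀ α = 0 := by
  have hS := hasDerivAt_netMass hi hc
  have hsplit := intervalIntegral.integral_Iic_add_Ioi (b := (0 : ℝ)) (f := ρ₀)
    hi.integrableOn hi.integrableOn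
  have h0 : netMass ρ₀ 0 = 2 * (∫ y in Iic (0 : ℝ), ρ₀ y) - mass ρ₀ := by
    rw [netMass, integral_sign_mul hi, mass]
  have htop : Tendsto (netMass ρ₀) atTop (𝓝 (mass ρ₀)) := by
    have := ((intervalIntegral_tendsto_integral_Ioi 0 hi.integrableOn tendsto_id).const_mul
      2).const_add (netMass ρ₀ 0)
    rw [show netMass ρ₀ 0 + 2 * ∫ y in Ioi (0 : ℝ), ρ₀ y = mass ρ₀ by
      rw [h0, mass, ← hsplit]; ring] at this
    refine this.congr fun β => ?_
    simp only [id]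
    linarith [netMass_sub hi 0 β]
  have hbot : Tendsto (netMass ρ₀) atBot (𝓝 (-mass ρ₀)) := by
    have := ((intervalIntegral_tendsto_integral_Iic 0 hi.integrableOn tendsto_id).const_mul
      (-2)).const_add (netMass ρ₀ 0)
    rw [show netMass ρ₀ 0 + -2 * ∫ y in Iic (0 : ℝ), ρ₀ y = -mass ρ₀ by
      rw [h0]; ring] at this
    refine this.congr fun β => ?_
    simp only [id]
    linarith [netMass_sub hi β 0]
  have hd : ∀ α, HasDerivAt (fun α => netMass ρ₀ α ^ 2 / 4) (netMass ρ₀ α * ρ₀ α) α := fun α =>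
    (((hS α).pow 2).div_const 4).congr_deriv (by norm_num; ring)
  have hint : Integrable fun α => netMass ρ₀ α * ρ₀ α := by
    refine hi.bdd_mul (c := ∫ y, |ρ₀ y|) ?_ (Eventually.of_forall fun α => ?_)
    · exact (continuous_iff_continuousAt.2 fun α => (hS α).continuousAt).aestronglyMeasurable
    · refine norm_integral_le_of_norm_le hi.abs (Eventually.of_forall fun β => ?_)
      rw [Real.norm_eq_abs, abs_mul]
      exact mul_le_of_le_one_left (abs_nonneg _) (abs_sign_le _)
  rw [integral_of_hasDerivAt_of_tendsto hd hint ((hbot.pow 2).div_const 4)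
    ((htop.pow 2).div_const 4)]
  ring

end NetMass

section FlowMap

variable {M : ℝ} {η η' ρ₀ u₀ : ℝ → ℝ}

theorem flowMap_zero (hη : IsFundamental M η η') (α : ℝ) : flowMap M η η' ρ₀ u₀ α 0 = α := by
  simp [flowMap, hη.zero, hη.one]

theorem flowVelocity_zero (hη : IsFundamental M η η') (α : ℝ) :
    flowVelocity M η η' ρ₀ u₀ α 0 = u₀ α := by
  simp [flowVelocity, hη.zero, hη.one]

theorem hasDerivAt_exp_neg (t : ℝ) : HasDerivAt (fun t => Real.exp (-t)) (-Real.exp (-t)) t :=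
  ((hasDerivAt_neg t).exp).congr_deriv (by ring)

theorem hasDerivAt_flowMap_time (hη : IsFundamental M η η') (hM : M ≠ 0) (α t : ℝ) :
    HasDerivAt (flowMap M η η' ρ₀ u₀ α) (flowVelocity M η η' ρ₀ u₀ α t) t := by
  refine (((((hη.hasDerivAt_phi t).mul_const _).add ((hη.hasDerivAt_psi t).mul_const _)).add
    (((hη.hasDerivAt_phi t).const_sub 1).mul_const _)).add
    ((((hasDerivAt_exp_neg t).const_sub 1).const_mul _).const_add _)).congr_deriv ?_
  unfold flowVelocity
  field_simp

theorem hasDerivAt_flowVelocity_time (hη : IsFundamental M η η') (hM : M ≠ 0) (α t : ℝ) :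
    HasDerivAt (flowVelocity M η η' ρ₀ u₀ α)
      (-flowVelocity M η η' ρ₀ u₀ α t + (netMass ρ₀ α - M * flowMap M η η' ρ₀ u₀ α t +
        ((∫ β, β * ρ₀ β) + (∫ β, u₀ β * ρ₀ β) * (1 - Real.exp (-t))))) t := by
  refine ((((((hη.hasDerivAt_psi t).const_mul (-M)).mul_const _).add
    (((hη.hasDerivAt_phi t).sub (hη.hasDerivAt_psi t)).mul_const _)).add
    ((hη.hasDerivAt_psi t).mul_const _)).add ((hasDerivAt_exp_neg t).const_mul _)).congr_deriv ?_
  unfold flowVelocity flowMap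
  field_simp
  ring

theorem hasDerivAt_flowMap_space (hi : Integrable ρ₀) (hc : Continuous ρ₀)
    (hu₀ : Differentiable ℝ u₀) (α t : ℝ) :
    HasDerivAt (fun α => flowMap M η η' ρ₀ u₀ α t) (jac M η η' (ρ₀ α) (deriv u₀ α) t) α := by
  refine (((((hasDerivAt_id α).sub_const _).const_mul (Real.exp (-t) * η' t)).add
    (((hu₀ α).hasDerivAt.sub_const _).const_mul (Real.exp (-t) * η t))).add
    (((hasDerivAt_netMass hi hc α).div_const M).const_mul (1 - Real.exp (-t) * η' t))
      |>.add_const _).congr_deriv ?_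
  unfold jac
  ring

theorem hasDerivAt_flowVelocity_space (hi : Integrable ρ₀) (hc : Continuous ρ₀)
    (hu₀ : Differentiable ℝ u₀) (α t : ℝ) :
    HasDerivAt (fun α => flowVelocity M η η' ρ₀ u₀ α t)
      (-M * (Real.exp (-t) * η t) +
        deriv u₀ α * (Real.exp (-t) * η' t - Real.exp (-t) * η t) +
        2 * (Real.exp (-t) * η t) * ρ₀ α) α := by
  refine (((((hasDerivAt_id α).sub_const _).const_mul (-M * (Real.exp (-t) * η t))).add
    (((hu₀ α).hasDerivAt.sub_const _).const_mul (Real.exp (-t) * η' t - Real.exp (-t) * η t))).add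
    ((hasDerivAt_netMass hi hc α).const_mul (Real.exp (-t) * η t))
      |>.add_const _).congr_deriv ?_
  ring

theorem hasDerivAt_jac_time (hη : IsFundamental M η η') (hM : M ≠ 0) (r d t : ℝ) :
    HasDerivAt (jac M η η' r d)
      (-M * (Real.exp (-t) * η t) + d * (Real.exp (-t) * η' t - Real.exp (-t) * η t) +
        2 * (Real.exp (-t) * η t) * r) t := by
  refine (((hη.hasDerivAt_phi t).add ((hη.hasDerivAt_psi t).const_mul d)).add
    ((((hη.hasDerivAt_phi t).const_sub 1).const_mul (2 / M)).mul_const r)).congr_deriv ?_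
  field_simp

/-- The centre of mass of the explicit flow: the antisymmetric forces cancel. -/
theorem integral_flowMap_mul (hM : M ≠ 0) (hmass : mass ρ₀ = M) (hi : Integrable ρ₀)
    (hc : Continuous ρ₀) (hpos : ∀ x, 0 ≤ ρ₀ x) (hi1 : Integrable fun β => β * ρ₀ β)
    (hiu : Integrable fun β => u₀ β * ρ₀ β) (t : ℝ) :
    Integrable (fun β => flowMap M η η' ρ₀ u₀ β t * ρ₀ β) ∧
    ∫ β, flowMap M η η' ρ₀ u₀ β t * ρ₀ β =
      (∫ β, β * ρ₀ β) + (∫ β, u₀ β * ρ₀ β) * (1 - Real.exp (-t)) := by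
  have hiS : Integrable fun β => netMass ρ₀ β * ρ₀ β := by
    refine hi.bdd_mul (c := mass ρ₀) ?_ (Eventually.of_forall fun α => abs_netMass_le hi hpos α)
    exact (continuous_iff_continuousAt.2
      fun α => (hasDerivAt_netMass hi hc α).continuousAt).aestronglyMeasurable
  set φ := Real.exp (-t) * η' t with hφ
  set ψ := Real.exp (-t) * η t with hψ
  set m := ∫ β, β * ρ₀ β with hm
  set p := ∫ β, u₀ β * ρ₀ β with hp
  set k := -φ * (m / M) - ψ * (p / M) + (m / M + p / M * (1 - Real.exp (-t))) with hk
  have he : (fun β => flowMap M η η' ρ₀ u₀ β t * ρ₀ β) = fun β =>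
      φ * (β * ρ₀ β) + (ψ * (u₀ β * ρ₀ β) + ((1 - φ) / M * (netMass ρ₀ β * ρ₀ β) + k * ρ₀ β)) := by
    funext β
    unfold flowMap
    rw [← hφ, ← hψ, ← hm, ← hp, hk]
    ring
  have i4 : Integrable fun β => (1 - φ) / M * (netMass ρ₀ β * ρ₀ β) + k * ρ₀ β :=
    (hiS.const_mul _).add (hi.const_mul k)
  have i3 : Integrable fun β =>
      ψ * (u₀ β * ρ₀ β) + ((1 - φ) / M * (netMass ρ₀ β * ρ₀ β) + k * ρ₀ β) :=
    (hiu.const_mul ψ).add i4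
  rw [he]
  refine ⟨(hi1.const_mul φ).add i3, ?_⟩
  rw [integral_add (hi1.const_mul φ) i3, integral_add (hiu.const_mul ψ) i4,
    integral_add (hiS.const_mul _) (hi.const_mul k), integral_const_mul, integral_const_mul,
    integral_const_mul, integral_const_mul, integral_netMass_mul hi hc, ← hm, ← hp,
    show ∫ β, ρ₀ β = M from hmass, hk]
  field_simp
  ring

end FlowMap

/-! ### Existence -/

/-- The derivative `(a, b) ↦ (J a + U b, b)` of the space-time flow map, as an isomorphism. -/
noncomputable def shearEquiv (J U : ℝ) (hJ : J ≠ 0) : (ℝ × ℝ) ≃L[ℝ] ℝ × ℝ :=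
  ContinuousLinearEquiv.equivOfInverse
    ((J • ContinuousLinearMap.fst ℝ ℝ ℝ + U • ContinuousLinearMap.snd ℝ ℝ ℝ).prod
      (ContinuousLinearMap.snd ℝ ℝ ℝ))
    ((J⁻¹ • (ContinuousLinearMap.fst ℝ ℝ ℝ - U • ContinuousLinearMap.snd ℝ ℝ ℝ)).prod
      (ContinuousLinearMap.snd ℝ ℝ ℝ))
    (fun p => by ext <;> simp [hJ]) (fun p => by ext <;> simp [hJ])

/-- The spatial inverse of a `C¹` family of increasing diffeomorphisms is jointly `C¹` up to the
initial time: near each point it is a component of the local inverse of `(α, t) ↦ (X α t, t)`. -/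
theorem contDiffOn_inverse {X A : ℝ → ℝ → ℝ} {J : ℝ → ℝ → ℝ}
    (hX : ContDiff ℝ 1 fun p : ℝ × ℝ => X p.1 p.2)
    (hJ : ∀ α t, HasDerivAt (fun α => X α t) (J α t) α) (hJ0 : ∀ α t, 0 ≤ t → 0 < J α t)
    (hinj : ∀ t, 0 ≤ t → Function.Injective fun α => X α t)
    (hA : ∀ x t, 0 ≤ t → X (A x t) t = x) :
    ContDiffOn ℝ 1 (fun p : ℝ × ℝ => A p.1 p.2) (univ ×ˢ Ici 0) := by
  rintro ⟨x, t⟩ ⟨-, ht⟩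
  have ht : 0 ≤ t := ht
  set α := A x t with hα
  have hαx : X α t = x := hA x t ht
  set Φ : ℝ × ℝ → ℝ × ℝ := fun p => (X p.1 p.2, p.2) with hΦ
  have hΦc : ContDiffAt ℝ 1 Φ (α, t) := (hX.prodMk contDiff_snd).contDiffAt
  have hd : HasFDerivAt (fun p : ℝ × ℝ => X p.1 p.2)
      (fderiv ℝ (fun p : ℝ × ℝ => X p.1 p.2) (α, t)) (α, t) :=
    (hX.differentiable one_ne_zero).differentiableAt.hasFDerivAt
  set L := fderiv ℝ (fun p : ℝ × ℝ => X p.1 p.2) (α, t) with hL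
  have hL1 : L (1, 0) = J α t :=
    (hasDerivAt_comp_curve hd (hasDerivAt_id α) (hasDerivAt_const α t)).unique (hJ α t)
  have hne := (hJ0 α t ht).ne'
  have hΦd : HasFDerivAt Φ (shearEquiv (J α t) (L (0, 1)) hne : ℝ × ℝ →L[ℝ] ℝ × ℝ) (α, t) := by
    refine (hd.prodMk hasFDerivAt_snd).congr_fderiv ?_
    refine ContinuousLinearMap.ext fun p => ?_
    have : L p = J α t * p.1 + L (0, 1) * p.2 := by
      conv_lhs => rw [show p = p.1 • ((1, 0) : ℝ × ℝ) + p.2 • ((0, 1) : ℝ × ℝ) by ext <;> simp]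
      rw [map_add, map_smul, map_smul, hL1, smul_eq_mul, smul_eq_mul]
      ring
    simp [shearEquiv, this]
  have hΦ0 : Φ (α, t) = (x, t) := by rw [hΦ]; simp [hαx]
  have hg := hΦc.to_localInverse hΦd one_ne_zero
  rw [hΦ0] at hg
  have hright := (hΦc.hasStrictFDerivAt' hΦd one_ne_zero).eventually_right_inverse
  rw [hΦ0] at hright
  refine (contDiffAt_fst.comp (x, t) hg).contDiffWithinAt.congr_of_eventuallyEq ?_ ?_
  · filter_upwards [hright.filter_mono nhdsWithin_le_nhds, self_mem_nhdsWithin] with q hq hq0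
    have h2 := congrArg Prod.snd hq
    have h1 := congrArg Prod.fst hq
    simp only [hΦ] at h1 h2
    rw [h2, ← hA q.1 q.2 hq0.2] at h1
    exact (hinj q.2 hq0.2 h1).symm
  · have := hΦc.localInverse_apply_image hΦd one_ne_zero
    rw [hΦ0] at this
    simp only [Function.comp_apply, this]
    exact hα.symm

section Regularity

variable {M : ℝ} {η η' ρ₀ u₀ : ℝ → ℝ}

theorem IsFundamental.contDiff (h : IsFundamental M η η') : ContDiff ℝ 1 η := by
  rw [contDiff_one_iff_deriv]
  refine ⟨fun t => (h.hasDerivAt t).differentiableAt, ?_⟩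
  rw [show deriv η = η' from funext fun t => (h.hasDerivAt t).deriv]
  exact h.continuous'

theorem IsFundamental.contDiff' (h : IsFundamental M η η') : ContDiff ℝ 1 η' := by
  rw [contDiff_one_iff_deriv]
  refine ⟨fun t => (h.hasDerivAt' t).differentiableAt, ?_⟩
  rw [show deriv η' = fun t => η' t - M * η t from funext fun t => (h.hasDerivAt' t).deriv]
  exact h.continuous'.sub (continuous_const.mul h.continuous)

theorem contDiff_netMass (hi : Integrable ρ₀) (hc : Continuous ρ₀) :
    ContDiff ℝ 1 (netMass ρ₀) := by
  rw [contDiff_one_iff_deriv]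
  refine ⟨fun t => (hasDerivAt_netMass hi hc t).differentiableAt, ?_⟩
  rw [show deriv (netMass ρ₀) = fun t => 2 * ρ₀ t from
    funext fun t => (hasDerivAt_netMass hi hc t).deriv]
  exact continuous_const.mul hc

theorem contDiff_flowMap (hη : IsFundamental M η η') (hi : Integrable ρ₀) (hc : Continuous ρ₀)
    (hu₀ : ContDiff ℝ 1 u₀) : ContDiff ℝ 1 fun p : ℝ × ℝ => flowMap M η η' ρ₀ u₀ p.1 p.2 := by
  have h1 := hη.contDiff
  have h2 := hη.contDiff'
  have h3 := contDiff_netMass hi hc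
  unfold flowMap
  fun_prop

theorem contDiff_flowVelocity (hη : IsFundamental M η η') (hi : Integrable ρ₀)
    (hc : Continuous ρ₀) (hu₀ : ContDiff ℝ 1 u₀) :
    ContDiff ℝ 1 fun p : ℝ × ℝ => flowVelocity M η η' ρ₀ u₀ p.1 p.2 := by
  have h1 := hη.contDiff
  have h2 := hη.contDiff'
  have h3 := contDiff_netMass hi hc
  unfold flowVelocity
  fun_prop

theorem contDiff_jac (hη : IsFundamental M η η') (hρ₀ : ContDiff ℝ 1 ρ₀) (hu₀ : ContDiff ℝ 2 u₀) :
    ContDiff ℝ 1 fun p : ℝ × ℝ => jac M η η' (ρ₀ p.1) (deriv u₀ p.1) p.2 := by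
  have h1 := hη.contDiff
  have h2 := hη.contDiff'
  have h3 : ContDiff ℝ 1 (deriv u₀) :=
    ((contDiff_succ_iff_deriv (n := 1)).1 (by simpa [one_add_one_eq_two] using hu₀)).2.2
  unfold jac
  fun_prop

theorem exists_abs_le_mul_one_add_abs {K : ℝ} (hu₀ : Differentiable ℝ u₀)
    (hK : ∀ x, |deriv u₀ x| ≤ K) (x : ℝ) : |u₀ x| ≤ (|u₀ 0| + K) * (1 + |x|) := by
  have hK0 : 0 ≤ K := (abs_nonneg _).trans (hK 0)
  have h1 : |u₀ x - u₀ 0| ≤ K * |x - 0| :=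
    Convex.norm_image_sub_le_of_norm_deriv_le (fun y _ => hu₀ y) (fun y _ => hK y) convex_univ
      (mem_univ 0) (mem_univ x)
  rw [sub_zero] at h1
  have h2 : |u₀ x| ≤ |u₀ x - u₀ 0| + |u₀ 0| := by
    simpa using abs_add_le (u₀ x - u₀ 0) (u₀ 0)
  nlinarith [abs_nonneg (u₀ 0), abs_nonneg x, mul_nonneg (abs_nonneg (u₀ 0)) (abs_nonneg x)]

/-- At most linear growth of the flow map and of its velocity, uniformly on bounded time
intervals. -/
theorem exists_linear_growth (hη : IsFundamental M η η') {B : ℝ} (hB : 0 ≤ B)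
    (hu : ∀ x, |u₀ x| ≤ B * (1 + |x|)) (hS : ∀ x, |netMass ρ₀ x| ≤ B) (T : ℝ) :
    ∃ C, 1 ≤ C ∧ ∀ α, ∀ t ∈ Icc 0 T, |flowMap M η η' ρ₀ u₀ α t| ≤ C * (1 + |α|) ∧
      |flowVelocity M η η' ρ₀ u₀ α t| ≤ C * (1 + |α|) := by
  have hc := hη.continuous
  have hc' := hη.continuous'
  have hlin : ∀ a b c d : ℝ → ℝ, Continuous a → Continuous b → Continuous c → Continuous d →
      ∃ C, ∀ α, ∀ t ∈ Icc 0 T,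
        |a t * α + b t * u₀ α + c t * netMass ρ₀ α + d t| ≤ C * (1 + |α|) := by
    intro a b c d ha hb hcc hd
    obtain ⟨C, hC⟩ := (isCompact_Icc (a := (0 : ℝ)) (b := T)).exists_bound_of_continuousOn
      (f := fun t => |a t| + |b t| * B + |c t| * B + |d t|) (by fun_prop)
    refine ⟨C, fun α t ht => ?_⟩
    have h1 := (le_abs_self _).trans (hC t ht)
    have h2 : |a t * α| ≤ |a t| * (1 + |α|) := by rw [abs_mul]; gcongr; linarith
    have h3 : |b t * u₀ α| ≤ |b t| * B * (1 + |α|) := by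
      rw [abs_mul, mul_assoc]; gcongr; exact hu α
    have h4 : |c t * netMass ρ₀ α| ≤ |c t| * B * (1 + |α|) := by
      rw [abs_mul]
      calc |c t| * |netMass ρ₀ α| ≤ |c t| * B * 1 := by rw [mul_one]; gcongr; exact hS α
        _ ≤ _ := by gcongr; linarith [abs_nonneg α]
    have h5 : |d t| ≤ |d t| * (1 + |α|) := le_mul_of_one_le_right (abs_nonneg _)
      (by linarith [abs_nonneg α])
    calc |a t * α + b t * u₀ α + c t * netMass ρ₀ α + d t|
        ≤ |a t * α| + |b t * u₀ α| + |c t * netMass ρ₀ α| + |d t| := by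
          refine (abs_add_le _ _).trans (add_le_add_left ?_ _)
          exact (abs_add_le _ _).trans (add_le_add_left (abs_add_le _ _) _)
      _ ≤ (|a t| + |b t| * B + |c t| * B + |d t|) * (1 + |α|) := by linarith
      _ ≤ C * (1 + |α|) := by gcongr
  set m := (∫ β, β * ρ₀ β) / M with hm
  set p := (∫ β, u₀ β * ρ₀ β) / M with hp
  obtain ⟨C₁, h₁⟩ := hlin (fun t => Real.exp (-t) * η' t) (fun t => Real.exp (-t) * η t)
    (fun t => (1 - Real.exp (-t) * η' t) / M)
    (fun t => -(Real.exp (-t) * η' t * m) - Real.exp (-t) * η t * p +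
      (m + p * (1 - Real.exp (-t)))) (by fun_prop) (by fun_prop) (by fun_prop) (by fun_prop)
  obtain ⟨C₂, h₂⟩ := hlin (fun t => -M * (Real.exp (-t) * η t))
    (fun t => Real.exp (-t) * η' t - Real.exp (-t) * η t) (fun t => Real.exp (-t) * η t)
    (fun t => M * (Real.exp (-t) * η t) * m -
      (Real.exp (-t) * η' t - Real.exp (-t) * η t) * p + p * Real.exp (-t))
    (by fun_prop) (by fun_prop) (by fun_prop) (by fun_prop)
  refine ⟨max 1 (max C₁ C₂), le_max_left _ _, fun α t ht => ⟨?_, ?_⟩⟩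
  · refine le_trans (le_of_eq ?_) ((h₁ α t ht).trans (mul_le_mul_of_nonneg_right
      ((le_max_left _ _).trans (le_max_right _ _)) (by positivity)))
    unfold flowMap
    congr 1
    ring
  · refine le_trans (le_of_eq ?_) ((h₂ α t ht).trans (mul_le_mul_of_nonneg_right
      ((le_max_right _ _).trans (le_max_right _ _)) (by positivity)))
    unfold flowVelocity
    congr 1
    ring

end Regularity

/-- Existence: a uniform positive lower bound on the Jacobian over bounded time intervals makes the
explicit flow a diffeomorphism of the line, and its Eulerian description is a global solution. -/
theorem exists_isGlobalSolution {δ M C K : ℝ} {ρ₀ u₀ η η' : ℝ → ℝ} (hδ : 0 < δ)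
    (hρ₀ : ContDiff ℝ 1 ρ₀) (hu₀ : ContDiff ℝ 2 u₀) (hpos : ∀ x, 0 < ρ₀ x)
    (hK : ∀ x, |deriv u₀ x| ≤ K) (hdec : DecaysWith δ C ρ₀) (hη : IsFundamental M η η')
    (hM : M ≠ 0) (hmass : mass ρ₀ = M)
    (hlow : ∀ T, 0 < T → ∃ c, 0 < c ∧ ∀ α, ∀ t ∈ Icc 0 T,
      c ≤ jac M η η' (ρ₀ α) (deriv u₀ α) t) :
    ∃ ρ u, IsGlobalSolution δ ρ₀ u₀ ρ u := by
  have hρc := hρ₀.continuous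
  have hu₁ : ContDiff ℝ 1 u₀ := hu₀.of_le (by norm_num)
  have hud : Differentiable ℝ u₀ := hu₁.differentiable one_ne_zero
  have hi := hdec.integrable hδ hρc
  have hi1 := hdec.integrable_id_mul hδ hρc
  have hK0 : 0 ≤ K := (abs_nonneg _).trans (hK 0)
  have hug := exists_abs_le_mul_one_add_abs hud hK
  have hiu := hdec.integrable_mul hδ hρc hu₀.continuous.aestronglyMeasurable (by positivity) hug
  have hJpos : ∀ α t, 0 ≤ t → 0 < jac M η η' (ρ₀ α) (deriv u₀ α) t := fun α t ht => by
    obtain ⟨c, hc, h⟩ := hlow (t + 1) (by linarith)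
    exact hc.trans_le (h α t ⟨ht, by linarith⟩)
  set X := flowMap M η η' ρ₀ u₀ with hX
  set U := flowVelocity M η η' ρ₀ u₀ with hU
  have hXd : ∀ α t, HasDerivAt (fun α => X α t) (jac M η η' (ρ₀ α) (deriv u₀ α) t) α :=
    hasDerivAt_flowMap_space hi hρc hud
  have hmono : ∀ t, 0 ≤ t → StrictMono fun α => X α t := fun t ht =>
    strictMono_of_deriv_pos fun α => by
      rw [(hXd α t).deriv]
      exact hJpos α t ht
  have hsurj : ∀ t, 0 ≤ t → Function.Surjective fun α => X α t := fun t ht => by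
    obtain ⟨c, hc, h⟩ := hlow (t + 1) (by linarith)
    have hm : Monotone fun α => X α t - c * α := by
      have hd : ∀ α, HasDerivAt (fun α => X α t - c * α)
          (jac M η η' (ρ₀ α) (deriv u₀ α) t - c * 1) α := fun α =>
        (hXd α t).sub ((hasDerivAt_id α).const_mul c)
      refine monotone_of_deriv_nonneg (fun α => (hd α).differentiableAt) fun α => ?_
      rw [(hd α).deriv]
      linarith [h α t ⟨ht, by linarith⟩]
    have hcX : Continuous fun α => X α t :=
      continuous_iff_continuousAt.2 fun α => (hXd α t).continuousAt
    refine hcX.surjective ?_ ?_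
    · refine tendsto_atTop_mono' atTop ?_
        (tendsto_atTop_add_const_left atTop (X 0 t) (tendsto_id.const_mul_atTop hc))
      filter_upwards [eventually_ge_atTop 0] with α hα
      have := hm hα
      simp only [mul_zero, id] at this ⊢
      linarith
    · refine tendsto_atBot_mono' atBot ?_
        (tendsto_atBot_add_const_left atBot (X 0 t) (tendsto_id.const_mul_atBot hc))
      filter_upwards [eventually_le_atBot 0] with α hα
      have := hm hα
      simp only [mul_zero, id] at this ⊢
      linarith
  set A : ℝ → ℝ → ℝ := fun x t => Function.invFun (fun α => X α t) x with hA
  have hXA : ∀ x t, 0 ≤ t → X (A x t) t = x := fun x t ht =>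
    Function.invFun_eq (f := fun α => X α t) (hsurj t ht x)
  have hAX : ∀ α t, 0 ≤ t → A (X α t) t = α := fun α t ht =>
    Function.leftInverse_invFun (hmono t ht).injective α
  have hAc : ContDiffOn ℝ 1 (fun p : ℝ × ℝ => A p.1 p.2) (univ ×ˢ Ici 0) :=
    contDiffOn_inverse (contDiff_flowMap hη hi hρc hu₁) hXd hJpos
      (fun t ht => (hmono t ht).injective) hXA
  have hAp : ContDiffOn ℝ 1 (fun p : ℝ × ℝ => (A p.1 p.2, p.2)) (univ ×ˢ Ici 0) :=
    hAc.prodMk contDiff_snd.contDiffOn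
  set ρ : ℝ → ℝ → ℝ := fun x t =>
    ρ₀ (A x t) / jac M η η' (ρ₀ (A x t)) (deriv u₀ (A x t)) t with hρ
  set u : ℝ → ℝ → ℝ := fun x t => U (A x t) t with hu
  have hρX : ∀ α t, 0 ≤ t → ρ (X α t) t * jac M η η' (ρ₀ α) (deriv u₀ α) t = ρ₀ α :=
    fun α t ht => by
      simp only [hρ, hAX α t ht]
      exact div_mul_cancel₀ _ (hJpos α t ht).ne'
  have huX : ∀ α t, 0 ≤ t → u (X α t) t = U α t := fun α t ht => by
    simp only [hu, hAX α t ht]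
  have hρC : ContDiffOn ℝ 1 (fun p : ℝ × ℝ => ρ p.1 p.2) (univ ×ˢ Ici 0) :=
    (hρ₀.comp_contDiffOn hAc).div ((contDiff_jac hη hρ₀ hu₀).comp_contDiffOn hAp)
      fun p hp => (hJpos _ _ hp.2).ne'
  have huC : ContDiffOn ℝ 1 (fun p : ℝ × ℝ => u p.1 p.2) (univ ×ˢ Ici 0) :=
    (contDiff_flowVelocity hη hi hρc hu₁).comp_contDiffOn hAp
  have hA0 : ∀ x, A x 0 = x := fun x => by
    have := hAX x 0 le_rfl
    rwa [show X x 0 = x from flowMap_zero hη x] at this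
  obtain ⟨B, hB0, hBu, hBS⟩ : ∃ B, 0 ≤ B ∧ (∀ x, |u₀ x| ≤ B * (1 + |x|)) ∧
      ∀ x, |netMass ρ₀ x| ≤ B := by
    refine ⟨max (|u₀ 0| + K) (mass ρ₀), (by positivity : 0 ≤ |u₀ 0| + K).trans (le_max_left _ _),
      fun x => (hug x).trans (mul_le_mul_of_nonneg_right (le_max_left _ _) (by positivity)),
      fun x => (abs_netMass_le hi (fun y => (hpos y).le) x).trans (le_max_right _ _)⟩
  have hρnn : ∀ x t, 0 ≤ t → 0 ≤ ρ x t := fun x t ht =>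
    div_nonneg (hpos _).le (hJpos _ t ht).le
  have hρle : ∀ c T, 0 < c → (∀ α, ∀ t ∈ Icc 0 T, c ≤ jac M η η' (ρ₀ α) (deriv u₀ α) t) →
      ∀ x, ∀ t ∈ Icc 0 T, ρ x t ≤ C * (1 + |A x t|) ^ (-(2 + δ)) / c := fun c T hc h x t ht => by
    have h1 : ρ₀ (A x t) ≤ C * (1 + |A x t|) ^ (-(2 + δ)) := (le_abs_self _).trans (hdec _)
    calc ρ x t ≤ ρ₀ (A x t) / c := by
          exact div_le_div_of_nonneg_left (hpos _).le hc (h _ t ht)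
      _ ≤ _ := by gcongr
  refine ⟨ρ, u, hρC, huC, fun x t ht => ?_, fun x t ht => ?_, fun x => ?_, fun x => ?_,
    fun t ht i hi' => ?_, fun T hT => ?_⟩
  · -- conservation of mass, from `ρ(X, t) J = ρ₀`
    obtain ⟨α, rfl⟩ := hsurj t ht.le x
    simp only
    have dX : HasDerivAt (X α) (u (X α t) t) t := by
      rw [huX α t ht.le]
      exact hasDerivAt_flowMap_time hη hM α t
    have d1 := (hasDerivAt_along hρC ht dX).mul
      (hasDerivAt_jac_time hη hM (ρ₀ α) (deriv u₀ α) t)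
    have d2 := (d1.congr_of_eventuallyEq (f₁ := fun _ => ρ₀ α) (by
      filter_upwards [Ici_mem_nhds ht] with s hs
      exact (hρX α s hs).symm)).unique (hasDerivAt_const t (ρ₀ α))
    have du := hasDerivAt_space huC ht (X α t)
    have dρ := hasDerivAt_space hρC ht (X α t)
    have d3 : deriv (fun y => u y t) (X α t) * jac M η η' (ρ₀ α) (deriv u₀ α) t = _ :=
      (HasDerivAt.comp (h := fun α => X α t) α du (hXd α t)).unique
        ((hasDerivAt_flowVelocity_space (M := M) (η := η) (η' := η') hi hρc hud
          α t).congr_of_eventuallyEq (Eventually.of_forall fun β => huX β t ht.le))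
    have d4 : deriv (fun y => ρ y t * u y t) (X α t) = _ := (dρ.mul du).deriv
    rw [d4]
    rw [← d3] at d2
    refine (mul_eq_zero.1 ?_).resolve_right (hJpos α t ht.le).ne'
    linear_combination d2
  · -- conservation of momentum, from the equation of the flow
    obtain ⟨α, rfl⟩ := hsurj t ht.le x
    simp only
    have dX : HasDerivAt (X α) (u (X α t) t) t := by
      rw [huX α t ht.le]
      exact hasDerivAt_flowMap_time hη hM α t
    have d1 := ((hasDerivAt_along huC ht dX).congr_of_eventuallyEq (f₁ := U α) (by
      filter_upwards [Ici_mem_nhds ht] with s hs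
      exact (huX α s hs).symm)).unique (hasDerivAt_flowVelocity_time hη hM α t)
    have hconv : dWConv (fun y => ρ y t) (X α t) =
        -netMass ρ₀ α + M * X α t - ∫ β, X β t * ρ₀ β := by
      obtain ⟨i1, -⟩ := integral_flowMap_mul (η := η) (η' := η') hM hmass hi hρc
        (fun x => (hpos x).le) hi1 hiu t
      have i2 := integrable_sign_mul hi α
      rw [dWConv_transport (hmono t ht.le) (hsurj t ht.le) (fun α => hXd α t)
        (fun α => hJpos α t ht.le) (fun α => hρX α t ht.le)]
      have he : (fun β => (-Real.sign (α - β) + (X α t - X β t)) * ρ₀ β) = fun β =>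
          (X α t * ρ₀ β - Real.sign (α - β) * ρ₀ β) - X β t * ρ₀ β := by
        funext β
        ring
      have i3 : Integrable fun β => X α t * ρ₀ β - Real.sign (α - β) * ρ₀ β :=
        (hi.const_mul _).sub i2
      rw [he, integral_sub i3 i1, integral_sub (hi.const_mul _) i2, integral_const_mul,
        show ∫ β, ρ₀ β = M from hmass, netMass]
      ring
    rw [hconv, (integral_flowMap_mul (η := η) (η' := η') hM hmass hi hρc
      (fun x => (hpos x).le) hi1 hiu t).2]
    rw [← hU, ← huX α t ht.le] at d1
    linear_combination d1
  · simp only [hρ, hA0, hη.jac_zero, div_one]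
  · simp only [hu, hA0]
    exact flowVelocity_zero hη x
  · -- `ρ |u|^i = O((1 + |α|)^{-δ})`, and `|α| → ∞` as `|x| → ∞`
    obtain ⟨c, hc, hcJ⟩ := hlow (t + 1) (by linarith)
    obtain ⟨D, hD1, hD⟩ := exists_linear_growth hη hB0 hBu hBS (t + 1)
    have htI : t ∈ Icc 0 (t + 1) := ⟨ht, by linarith⟩
    have hC0 := hdec.nonneg
    have hinf : Tendsto (fun x => 1 + |A x t|) (cocompact ℝ) atTop := by
      refine tendsto_atTop_mono (fun x => ?_)
        ((tendsto_norm_cocompact_atTop (E := ℝ)).atTop_div_const (zero_lt_one.trans_le hD1))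
      rw [div_le_iff₀' (zero_lt_one.trans_le hD1), Real.norm_eq_abs]
      have := (hD (A x t) t htI).1
      rwa [← hX, hXA x t ht] at this
    have hlim : Tendsto (fun x => C / c * D ^ 2 * (1 + |A x t|) ^ (-δ)) (cocompact ℝ) (𝓝 0) := by
      simpa using ((tendsto_rpow_neg_atTop hδ).comp hinf).const_mul (C / c * D ^ 2)
    refine squeeze_zero (fun x => mul_nonneg (hρnn x t ht) (by positivity)) (fun x => ?_) hlim
    have h1 := hρle c (t + 1) hc hcJ x t htI
    have h2 : |u x t| ≤ D * (1 + |A x t|) := (hD (A x t) t htI).2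
    have h3 : 1 ≤ D * (1 + |A x t|) := by nlinarith [abs_nonneg (A x t)]
    have h4 : |u x t| ^ i ≤ (D * (1 + |A x t|)) ^ 2 := by
      refine (pow_le_pow_left₀ (abs_nonneg _) h2 i).trans (pow_le_pow_right₀ h3 ?_)
      omega
    have hp : 0 < 1 + |A x t| := by positivity
    calc ρ x t * |u x t| ^ i
        ≤ C * (1 + |A x t|) ^ (-(2 + δ)) / c * (D * (1 + |A x t|)) ^ 2 := by
          gcongr
      _ = C / c * D ^ 2 * ((1 + |A x t|) ^ (-(2 + δ)) * (1 + |A x t|) ^ (2 : ℝ)) := by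
          rw [Real.rpow_two]
          ring
      _ = _ := by
          rw [← Real.rpow_add hp]
          ring_nf
  · obtain ⟨c, hc, hcJ⟩ := hlow T hT
    obtain ⟨D, hD1, hD⟩ := exists_linear_growth hη hB0 hBu hBS T
    have hC0 := hdec.nonneg
    refine ⟨D ^ (2 + δ) * (C / c), fun x t ht0 htT => ?_⟩
    have htI : t ∈ Icc 0 T := ⟨ht0, htT.le⟩
    have hp : 0 < 1 + |A x t| := by positivity
    have hx : |x| ≤ D * (1 + |A x t|) := by
      have := (hD (A x t) t htI).1
      rwa [← hX, hXA x t ht0] at this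
    rw [abs_of_nonneg (hρnn x t ht0)]
    calc |x| ^ (2 + δ) * ρ x t
        ≤ (D * (1 + |A x t|)) ^ (2 + δ) * (C * (1 + |A x t|) ^ (-(2 + δ)) / c) := by
          gcongr
          · exact hρnn x t ht0
          · exact hρle c T hc hcJ x t htI
      _ = D ^ (2 + δ) * (C / c) * ((1 + |A x t|) ^ (2 + δ) * (1 + |A x t|) ^ (-(2 + δ))) := by
          rw [Real.mul_rpow (by linarith) hp.le]
          ring
      _ = _ := by
          rw [← Real.rpow_add hp, add_neg_cancel, Real.rpow_zero, mul_one]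

/-! ### The sharp criterion -/

section InitialData

variable {δ K : ℝ} {ρ₀ : ℝ → ℝ}

theorem exists_decaysWith_of_sqrt (hδ : 0 < δ)
    (h : ∀ x, Real.sqrt (1 + x ^ 2) ^ (2 + δ) * ρ₀ x ≤ K) (hpos : ∀ x, 0 < ρ₀ x) :
    ∃ C, DecaysWith δ C ρ₀ := by
  have h1 : ∀ x : ℝ, |x| ≤ Real.sqrt (1 + x ^ 2) := fun x => by
    rw [← Real.sqrt_sq_eq_abs]
    exact Real.sqrt_le_sqrt (by linarith)
  have h2 : ∀ x : ℝ, 1 ≤ Real.sqrt (1 + x ^ 2) := fun x => by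
    rw [Real.one_le_sqrt]
    nlinarith [sq_nonneg x]
  have h3 : ∀ x, ρ₀ x ≤ K := fun x => by
    refine le_trans (le_mul_of_one_le_left (hpos x).le ?_) (h x)
    exact Real.one_le_rpow (h2 x) (by linarith)
  refine ⟨_, decaysWith_of_abs_rpow_le hδ ((hpos 0).le.trans (h3 0)) (A := K) (B := K)
    (fun x => ?_) fun x _ => ?_⟩
  · rw [abs_of_pos (hpos x)]
    refine le_trans ?_ (h x)
    have := (hpos x).le
    gcongr
    exact h1 x
  · rw [abs_of_pos (hpos x)]
    exact h3 x

theorem DecaysWith.tendsto_zero {C : ℝ} (hδ : 0 < δ) (h : DecaysWith δ C ρ₀) :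
    Tendsto ρ₀ (cocompact ℝ) (𝓝 0) := by
  have hinf : Tendsto (fun x : ℝ => 1 + |x|) (cocompact ℝ) atTop :=
    tendsto_atTop_add_const_left _ 1 (tendsto_norm_cocompact_atTop (E := ℝ))
  have hlim : Tendsto (fun x : ℝ => C * (1 + |x|) ^ (-(2 + δ))) (cocompact ℝ) (𝓝 0) := by
    simpa using ((tendsto_rpow_neg_atTop (by linarith : 0 < 2 + δ)).comp hinf).const_mul C
  exact squeeze_zero_norm h hlim

theorem mass_pos (hi : Integrable ρ₀) (hpos : ∀ x, 0 < ρ₀ x) :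
    0 < mass ρ₀ := by
  unfold mass
  rw [integral_pos_iff_support_of_nonneg (fun x => (hpos x).le) hi]
  rw [show Function.support ρ₀ = univ from eq_univ_of_forall fun x => (hpos x).ne']
  simp

end InitialData

variable {δ M : ℝ} {ρ₀ u₀ η η' : ℝ → ℝ} {ρ u : ℝ → ℝ → ℝ}

theorem IsGlobalSolution.jac_pos (h : IsGlobalSolution δ ρ₀ u₀ ρ u) (hδ : 0 < δ)
    (hρ₀ : Continuous ρ₀) (hu₀ : Differentiable ℝ u₀) (hpos : ∀ x, 0 < ρ₀ x)
    (hη : IsFundamental M η η') (hM : M ≠ 0) (hmass : mass ρ₀ = M) (α : ℝ) {t : ℝ} (ht : 0 ≤ t) :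
    0 < jac M η η' (ρ₀ α) (deriv u₀ α) t := by
  obtain ⟨X, -, -, hX⟩ := h.exists_flow hδ hρ₀ hu₀ hpos hη hM hmass (T := t + 1) (by linarith)
  exact (hX t ⟨ht, by linarith⟩).2.2.2.1 α

/-- The initial velocity of a classical solution is `C²`: the Jacobian at time `1` is the quotient
of `ρ₀` by the `C¹` function `ρ(X, 1)`, and it determines `u₀'`. -/
theorem IsGlobalSolution.contDiff_two (h : IsGlobalSolution δ ρ₀ u₀ ρ u) (hδ : 0 < δ)
    (hρ₀ : ContDiff ℝ 1 ρ₀) (hu₀ : ContDiff ℝ 1 u₀) (hpos : ∀ x, 0 < ρ₀ x)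
    (hη : IsFundamental M η η') (hM : M ≠ 0) (hmass : mass ρ₀ = M) (hη1 : η 1 ≠ 0) :
    ContDiff ℝ 2 u₀ := by
  have hud := hu₀.differentiable one_ne_zero
  obtain ⟨X, -, -, hX⟩ := h.exists_flow hδ hρ₀.continuous hud hpos hη hM hmass zero_lt_one
  obtain ⟨-, -, hd, hJ, hρ, -⟩ := hX 1 ⟨zero_le_one, le_rfl⟩
  have hdc : Continuous (deriv u₀) := hu₀.continuous_deriv le_rfl
  have hXc : ContDiff ℝ 1 fun α => X α 1 := by
    rw [contDiff_one_iff_deriv]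
    refine ⟨fun α => (hd α).differentiableAt, ?_⟩
    rw [show deriv (fun α => X α 1) = _ from funext fun α => (hd α).deriv]
    exact hη.continuous_jac.comp (hρ₀.continuous.prodMk (hdc.prodMk continuous_const))
  have hρX : ContDiff ℝ 1 fun α => ρ (X α 1) 1 :=
    h.contDiff_density.comp_contDiff (g := fun p : ℝ × ℝ => ρ p.1 p.2)
      (f := fun α => (X α 1, (1 : ℝ))) (hXc.prodMk contDiff_const)
      fun α => ⟨mem_univ _, zero_le_one (α := ℝ)⟩
  have hρ0 : ∀ α, ρ (X α 1) 1 ≠ 0 := fun α e => by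
    have := hρ α
    rw [e, zero_mul] at this
    exact (hpos α).ne this
  have hψ : Real.exp (-1) * η 1 ≠ 0 := mul_ne_zero (Real.exp_pos _).ne' hη1
  have he : deriv u₀ = fun α => (ρ₀ α / ρ (X α 1) 1 - Real.exp (-1) * η' 1 -
      2 / M * (1 - Real.exp (-1) * η' 1) * ρ₀ α) / (Real.exp (-1) * η 1) := by
    funext α
    rw [eq_div_iff hψ, ← hρ α, mul_div_cancel_left₀ _ (hρ0 α), hρ α, jac]
    ring
  have : ContDiff ℝ (1 + 1) u₀ := by
    rw [contDiff_succ_iff_deriv]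
    refine ⟨hud, by simp, ?_⟩
    rw [he]
    exact (((hρ₀.div hρX hρ0).sub contDiff_const).sub (contDiff_const.mul hρ₀)).div_const _
  simpa [one_add_one_eq_two] using this

/-- The criterion for masses `M ≤ 1/4`. -/
theorem hasUniqueGlobalSolution_iff_of_le {K C : ℝ} (hδ : 0 < δ)
    (hρ₀ : ContDiff ℝ 1 ρ₀) (hu₀ : ContDiff ℝ 1 u₀) (hpos : ∀ x, 0 < ρ₀ x)
    (hK : ∀ x, |deriv u₀ x| ≤ K) (hdec : DecaysWith δ C ρ₀) (hM : 0 < M) (hmass : mass ρ₀ = M)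
    (hη : IsFundamental M η η') (hηpos : ∀ t, 0 ≤ t → t ≤ η t) (hηneg : ∀ t < 0, η t < 0)
    {R : ℝ → ℝ} (hR : ∀ τ, 0 ≤ τ → R (curve M η η' τ) = 2 * η τ) :
    HasUniqueGlobalSolution δ ρ₀ u₀ ↔
      ContDiff ℝ 2 u₀ ∧ ∀ x, (ρ₀ x, deriv u₀ x) ∈ regionAbove R := by
  have hM' := hM.ne'
  have hud := hu₀.differentiable one_ne_zero
  have hτ : ∀ x, ∃ τ, 0 < τ ∧ ρ₀ x * curve M η η' τ = 1 ∧ R (1 / ρ₀ x) = 2 * η τ := fun x => by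
    obtain ⟨τ, hτ, e⟩ := hη.exists_curve_eq hM' hηpos (one_div_pos.2 (hpos x))
    refine ⟨τ, hτ, ?_, ?_⟩
    · rw [e]
      exact mul_one_div_cancel (hpos x).ne'
    · rw [← e]
      exact hR τ hτ.le
  have hregion : ∀ x, (ρ₀ x, deriv u₀ x) ∈ regionAbove R ↔
      ∀ t, 0 ≤ t → 0 < jac M η η' (ρ₀ x) (deriv u₀ x) t := fun x => by
    obtain ⟨τ, hτ0, hr, hRx⟩ := hτ x
    rw [hη.jac_pos_iff hM' hηpos hηneg hτ0 hr]
    simp only [regionAbove, mem_ofPred_eq, hRx, hpos x, and_true]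
  constructor
  · rintro ⟨ρ, u, h, -⟩
    exact ⟨h.contDiff_two hδ hρ₀ hu₀ hpos hη hM' hmass (IsFundamental.eta_pos hηpos one_pos).ne',
      fun x => (hregion x).2 fun t ht => h.jac_pos hδ hρ₀.continuous hud hpos hη hM' hmass x ht⟩
  · rintro ⟨hu₂, hreg⟩
    have hlow : ∀ T, 0 < T → ∃ c, 0 < c ∧ ∀ α, ∀ t ∈ Icc 0 T,
        c ≤ jac M η η' (ρ₀ α) (deriv u₀ α) t := by
      intro T hT
      have hcpos : 0 < curve M η η' (T + 1) := by
        have := hη.sq_le_curve hM' hηpos (t := T + 1) (by linarith)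
        nlinarith
      -- outside a compact set the density is so small that `exp_le_jac` applies
      have hev := (hdec.tendsto_zero hδ).eventually
        (gt_mem_nhds (one_div_pos.2 hcpos))
      obtain ⟨S, hS, hSsub⟩ := mem_cocompact.1 hev
      have hdc : Continuous (deriv u₀) := hu₀.continuous_deriv le_rfl
      have hjc : Continuous fun p : ℝ × ℝ => jac M η η' (ρ₀ p.1) (deriv u₀ p.1) p.2 :=
        hη.continuous_jac.comp ((hρ₀.continuous.comp continuous_fst).prodMk
          ((hdc.comp continuous_fst).prodMk continuous_snd))
      have hin : ∃ c, 0 < c ∧ ∀ α ∈ S, ∀ t ∈ Icc 0 T,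
          c ≤ jac M η η' (ρ₀ α) (deriv u₀ α) t := by
        obtain ⟨c, hc, h⟩ := (hS.prod (isCompact_Icc (a := (0 : ℝ)) (b := T))).exists_forall_le'
          hjc.continuousOn (a := 0) fun p hp => (hregion p.1).1 (hreg p.1) p.2 hp.2.1
        exact ⟨c, hc, fun α hα t ht => h (α, t) ⟨hα, ht⟩⟩
      obtain ⟨c, hc, hcS⟩ := hin
      refine ⟨min c (Real.exp (-3 * T)), lt_min hc (Real.exp_pos _), fun α t ht => ?_⟩
      by_cases hα : α ∈ S
      · exact (min_le_left _ _).trans (hcS α hα t ht)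
      · have hsmall : ρ₀ α < 1 / curve M η η' (T + 1) := hSsub hα
        obtain ⟨τ, hτ0, hr, hRx⟩ := hτ α
        have hlarge : T + 1 ≤ τ := by
          by_contra! hlt
          have hmono := hη.strictMonoOn_curve hM' (convex_Ici 0) fun t ht => by
            rw [interior_Ici] at ht
            exact IsFundamental.eta_pos hηpos ht
          have h1 := hmono (mem_Ici.2 hτ0.le) (mem_Ici.2 (by linarith : 0 ≤ T + 1)) hlt
          rw [lt_div_iff₀ hcpos] at hsmall
          nlinarith [hpos α]
        have hd : -ρ₀ α * (2 * η τ) < deriv u₀ α := by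
          rw [← hRx]
          exact (hreg α).1
        refine (min_le_right _ _).trans (le_trans ?_
          (hη.exp_le_jac hM hηpos hηneg hr hd ht.1 (by linarith [ht.2])))
        exact Real.exp_le_exp.2 (by linarith [ht.2])
    obtain ⟨ρ, u, h⟩ := exists_isGlobalSolution hδ hρ₀ hu₂ hpos hK hdec hη hM' hmass hlow
    exact ⟨ρ, u, h, fun ρ' u' h' x t ht =>
      h.unique h' hδ hρ₀.continuous hud hpos hη hM' hmass x ht⟩

/-- Above the critical mass every flow breaks down: after half a period the homogeneous part of the
Jacobian is negative whatever the velocity gradient, and the density is small far away. -/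
theorem not_isGlobalSolution_of_gt {C : ℝ} (hδ : 0 < δ) (hρ₀ : Continuous ρ₀)
    (hu₀ : Differentiable ℝ u₀) (hpos : ∀ x, 0 < ρ₀ x) (hdec : DecaysWith δ C ρ₀)
    (hM : 1 / 4 < M) (hmass : mass ρ₀ = M) : ¬ IsGlobalSolution δ ρ₀ u₀ ρ u := by
  intro h
  have hω0 : 0 < Real.sqrt (M - 1 / 4) := Real.sqrt_pos.2 (by linarith)
  have hη := isFundamental_of_gt hM
  set ω := Real.sqrt (M - 1 / 4) with hω
  have hωb : ω * (Real.pi / ω) = Real.pi := by field_simp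
  have hb0 : 0 ≤ Real.pi / ω := by positivity
  set P := Real.exp (-(Real.pi / ω)) * Real.exp (Real.pi / ω / 2) with hP
  have hP0 : 0 < P := by positivity
  have hJ : ∀ α, 0 < -P + 2 / M * (1 + P) * ρ₀ α := fun α => by
    have := h.jac_pos hδ hρ₀ hu₀ hpos hη (by linarith) hmass α hb0
    simp only [jac, hωb, Real.sin_pi, Real.cos_pi] at this
    rw [hP]
    ring_nf at this ⊢
    linarith
  have hlim : Tendsto (fun α => -P + 2 / M * (1 + P) * ρ₀ α) (cocompact ℝ) (𝓝 (-P)) := by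
    simpa using ((hdec.tendsto_zero hδ).const_mul (2 / M * (1 + P))).const_add (-P)
  have := ge_of_tendsto' hlim fun α => (hJ α).le
  linarith

end Aggregation

theorem theorem5p3 (δ : ℝ) (hδ : 0 < δ) (ρ₀ u₀ : ℝ → ℝ)
    (hρ₀ : ContDiff ℝ 1 ρ₀) (hu₀ : ContDiff ℝ 1 u₀) (hpos : ∀ x, 0 < ρ₀ x)
    (hu₀' : ∃ K : ℝ, ∀ x, |deriv u₀ x| ≤ K)
    (hdecay : ∃ K : ℝ, ∀ x, Real.sqrt (1 + x ^ 2) ^ (2 + δ) * ρ₀ x ≤ K) :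
    (Aggregation.mass ρ₀ < 1 / 4 →
      ∃ Ra : ℝ → ℝ, Aggregation.IsUpperBranch (Aggregation.mass ρ₀) (Ici 0) Ra ∧
        (∀ R, Aggregation.IsUpperBranch (Aggregation.mass ρ₀) (Ici 0) R → EqOn R Ra (Ici 0)) ∧
        (Aggregation.HasUniqueGlobalSolution δ ρ₀ u₀ ↔
          ContDiff ℝ 2 u₀ ∧ ∀ x, (ρ₀ x, deriv u₀ x) ∈ Aggregation.regionAbove Ra)) ∧
    (Aggregation.mass ρ₀ = 1 / 4 →
      ∃ Rb : ℝ → ℝ, Aggregation.IsUpperBranch (1 / 4) (Ici 0) Rb ∧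
        (∀ R, Aggregation.IsUpperBranch (1 / 4) (Ici 0) R → EqOn R Rb (Ici 0)) ∧
        (Aggregation.HasUniqueGlobalSolution δ ρ₀ u₀ ↔
          ContDiff ℝ 2 u₀ ∧ ∀ x, (ρ₀ x, deriv u₀ x) ∈ Aggregation.regionAbove Rb)) ∧
    (1 / 4 < Aggregation.mass ρ₀ →
      ∃ R₁ R₂ : ℝ → ℝ,
        Aggregation.IsUpperBranch (Aggregation.mass ρ₀)
          (Icc 0 (Aggregation.gammaStar (Aggregation.mass ρ₀))) R₁ ∧
        (∀ R, Aggregation.IsUpperBranch (Aggregation.mass ρ₀)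
            (Icc 0 (Aggregation.gammaStar (Aggregation.mass ρ₀))) R →
          EqOn R R₁ (Icc 0 (Aggregation.gammaStar (Aggregation.mass ρ₀)))) ∧
        Aggregation.IsLowerBranch (Aggregation.mass ρ₀)
          (Aggregation.gammaStar (Aggregation.mass ρ₀)) R₂ ∧
        (∀ R, Aggregation.IsLowerBranch (Aggregation.mass ρ₀)
            (Aggregation.gammaStar (Aggregation.mass ρ₀)) R →
          EqOn R R₂ (Icc 0 (Aggregation.gammaStar (Aggregation.mass ρ₀)))) ∧
        (Aggregation.HasUniqueGlobalSolution δ ρ₀ u₀ ↔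
          ContDiff ℝ 2 u₀ ∧ ∀ x, (ρ₀ x, deriv u₀ x) ∈
            Aggregation.regionBetween (Aggregation.gammaStar (Aggregation.mass ρ₀)) R₁ R₂)) := by
  obtain ⟨K, hK⟩ := hu₀'
  obtain ⟨K', hK'⟩ := hdecay
  obtain ⟨C, hC⟩ := Aggregation.exists_decaysWith_of_sqrt hδ hK' hpos
  have hM : 0 < Aggregation.mass ρ₀ :=
    Aggregation.mass_pos (hC.integrable hδ hρ₀.continuous) hpos
  have hle : ∀ M, Aggregation.mass ρ₀ = M → M ≤ 1 / 4 →
      ∃ R : ℝ → ℝ, Aggregation.IsUpperBranch M (Ici 0) R ∧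
        (∀ R', Aggregation.IsUpperBranch M (Ici 0) R' → EqOn R' R (Ici 0)) ∧
        (Aggregation.HasUniqueGlobalSolution δ ρ₀ u₀ ↔
          ContDiff ℝ 2 u₀ ∧ ∀ x, (ρ₀ x, deriv u₀ x) ∈ Aggregation.regionAbove R) := by
    rintro M rfl hle
    obtain ⟨η, η', hη, hηpos, hηneg⟩ := Aggregation.exists_isFundamental_of_le hle
    obtain ⟨R, hR, hRη⟩ := hη.exists_isUpperBranch_Ici hM.ne' hηpos
    exact ⟨R, hR, fun R' hR' => hR'.eqOn_Ici hM hR,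
      Aggregation.hasUniqueGlobalSolution_iff_of_le hδ hρ₀ hu₀ hpos hK hC hM rfl hη hηpos hηneg
        hRη⟩
  refine ⟨fun h => hle _ rfl h.le, fun h => hle _ h le_rfl, fun h => ?_⟩
  obtain ⟨⟨R₁, hR₁⟩, R₂, hR₂⟩ := Aggregation.exists_branches_of_gt h
  have hγ := Aggregation.two_div_lt_gammaStar hM
  have hγ0 : 0 < Aggregation.gammaStar (Aggregation.mass ρ₀) := lt_trans (by positivity) hγ
  refine ⟨R₁, R₂, hR₁, fun R hR => hR.eqOn_Icc hM hγ0 hR₁, hR₂, fun R hR => hR.eqOn hM hγ hR₂,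
    ?_, ?_⟩
  · rintro ⟨ρ, u, hsol, -⟩
    exact absurd hsol (Aggregation.not_isGlobalSolution_of_gt hδ hρ₀.continuous
      (hu₀.differentiable one_ne_zero) hpos hC h rfl)
  · -- the density tends to zero, so it cannot stay above `1 / γ`
    rintro ⟨-, hreg⟩
    have := ge_of_tendsto' (hC.tendsto_zero hδ) fun x => (hreg x).2.2.le
    exact absurd this (not_le.2 (one_div_pos.2 hγ0))
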